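/- Let $p$ be a prime number. Let $\mathbb A_{\mathbb Q,p}=\{a\in\mathbb A_{\mathbb Q} : a_p=0\}$ be the space of adeles of $\mathbb Q$ with vanishing component at $p$, let $$\mathbb A^{(1)}_{\mathbb Q,p}=\{a\in\mathbb A_{\mathbb Q,p} : |a_w|\le 1 \text{ for all finite places } w,\ |a_\infty|<1\},$$ $$\mathbb A^{*}_{\mathbb Q,p}=\{a\in\mathbb A_{\mathbb Q,p} : |a_w|=1 \text{ for all finite places } w\ne p,\ p^{-1}\le |a_\infty|<1\},$$ and let $\mathcal G(p)=\{(k,x) : k\in\mathbb Q^*,\ x\in\mathbb A^{(1)}_{\mathbb Q,p},\ kx\in\mathbb A^{(1)}_{\mathbb Q,p}\}$ be the étale groupoid with source $x$, range $kx$ and product $(k,k'x)(k',x)=(kk',x)$ ($\mathbb Q^*$ being discrete). Let $C^*(\mathcal G(p))$ be its $C^*$-algebra, the completion of the convolution algebra $C_c(\mathcal G(p))$ in the full $C^*$-norm, with the time evolution given by $\sigma^p_t(f)(k,x)=|k|_p^{it}f(k,x)$ on $C_c(\mathcal G(p))$. For $y\in\mathbb A^{*}_{\mathbb Q,p}$ let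 $\mathcal G(p)_y=\{k\in\mathbb Q^* : ky\in\mathbb A^{(1)}_{\mathbb Q,p}\}$, let $\pi_y$ be the representation of $C^*(\mathcal G(p))$ on $\ell^2(\mathcal G(p)_y)$ by left convolution, $(\pi_y(f)\xi)(k)=\sum_{s} f(ks^{-1},sy)\,\xi(s)$, and let $H_y$ be the operator of multiplication by $\log|k|_p$ on $\ell^2(\mathcal G(p)_y)$ with its maximal domain. Then: 1. For every $y\in\mathbb A^{*}_{\mathbb Q,p}$ the representation $\pi_y$ has positive energy: the operator $H_y$ is self-adjoint and nonnegative, and it implements the time evolution, $\pi_y(\sigma^p_t(a))=e^{itH_y}\pi_y(a)e^{-itH_y}$ for all $a\in C^*(\mathcal G(p))$ and $t\in\mathbb R$. The spectrum of $H_y$ is $\{k\log p : k\in\mathbb N\cup\{0\}\}$. 2. Let $\beta>1$, let $y\in\mathbb A^{*}_{\mathbb Q,p}$, and let $\lambda\in(1,p]$ be given by $|y_\infty|=\lambda^{-1}$. Then $e^{-\beta H_y}$ is of trace class and $$Z_p(\lambda,\beta)=\operatorname{Tr}(e^{-\beta H_y})=2\,\frac{1-p^{-\beta}}{1-p^{1-\beta}}\,f_p(\lambda,\beta),\qquad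 f_p(\lambda,\beta)=\sum_{k\ge 0}c_k\,p^{-k\beta},$$ where $c_k=\lceil\lambda p^k-1\rceil-p\,\lceil\lambda p^{k-1}-1\rceil\in\{0,\dots,p-1\}$ are the digits of the expansion $\lambda=\sum_{k\ge0}c_kp^{-k}$ in base $p$ (the non-terminating one if there are two). 3. Let $\beta>1$. For every $y\in\mathbb A^{*}_{\mathbb Q,p}$ and $a\in C^*(\mathcal G(p))$ the operator $e^{-\beta H_y}\pi_y(a)$ is of trace class, and $$\psi_{\beta,y}(a)=\operatorname{Tr}(e^{-\beta H_y}\pi_y(a))$$ is a positive bounded linear functional of norm $Z_p(\lambda,\beta)$ on $C^*(\mathcal G(p))$ (so that $Z_p(\lambda,\beta)^{-1}\psi_{\beta,y}$ is a state) which satisfies the KMS$_\beta$ condition for $\sigma^p_t$. These functionals depend weakly continuously on $y$: for every $a\in C^*(\mathcal G(p))$ the function $y\mapsto\psi_{\beta,y}(a)$ is continuous on $\mathbb A^{*}_{\mathbb Q,p}$. -/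

import Mathlib

noncomputable section

open scoped ComplexConjugate

namespace ValuationSystem

section Groupoid

variable (Γ X : Type) [Group Γ] [TopologicalSpace X] [MulAction Γ X] (U : Set X)

/-- The slice over `k` of the reduction to `U ⊆ X` of the transformation groupoid `Γ ⋉ X`: the
points `x` for which `(k, x)` is an arrow, that is, source `x` and range `k • x` are in `U`. -/
def arrows {Γ X : Type} [Group Γ] [MulAction Γ X] (U : Set X) (k : Γ) : Set X :=
  {x | x ∈ U ∧ k • x ∈ U}

/-- For a discrete group `Γ`, a Hausdorff space `X` and an open `U`: the space `C_c(G)` of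
continuous compactly supported functions on the reduced groupoid
`G = {(k, x) | x ∈ U, k • x ∈ U}`, a function being extended by zero to `Γ × X`. -/
def ccSubmodule : Submodule ℂ (Γ → X → ℂ) where
  carrier := {f | {k | f k ≠ 0}.Finite ∧ ∀ k, Continuous (f k) ∧ HasCompactSupport (f k) ∧
    tsupport (f k) ⊆ arrows U k}
  zero_mem' := by
    refine ⟨by simp, fun k => ⟨continuous_const, HasCompactSupport.zero, ?_⟩⟩
    simp [tsupport]
  add_mem' := by
    rintro f g ⟨hf, hf'⟩ ⟨hg, hg'⟩
    refine ⟨(hf.union hg).subset ?_, fun k => ⟨(hf' k).1.add (hg' k).1,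
      (hf' k).2.1.add (hg' k).2.1, ?_⟩⟩
    · intro k hk
      by_contra h
      simp only [Set.mem_union, Set.mem_ofPred_eq, not_or, not_not] at h
      exact hk (by simp [h.1, h.2])
    · exact (tsupport_add (f k) (g k)).trans (Set.union_subset (hf' k).2.2 (hg' k).2.2)
  smul_mem' := by
    rintro c f ⟨hf, hf'⟩
    refine ⟨hf.subset ?_, fun k => ⟨(hf' k).1.const_smul c, ?_, ?_⟩⟩
    · intro k hk h
      exact hk (by simp [h])
    · exact (hf' k).2.1.comp_left (g := fun z => c • z) (smul_zero c)
    · exact (tsupport_smul_subset_right (fun _ => c) (f k)).trans (hf' k).2.2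

/-- The convolution algebra `C_c(G)` of the reduced groupoid. -/
def Cc : Type := ccSubmodule Γ X U

instance : AddCommGroup (Cc Γ X U) := inferInstanceAs (AddCommGroup (ccSubmodule Γ X U))
instance : Module ℂ (Cc Γ X U) := inferInstanceAs (Module ℂ (ccSubmodule Γ X U))
instance : CoeFun (Cc Γ X U) (fun _ => Γ → X → ℂ) := ⟨fun f => f.1⟩

variable {Γ X U}

namespace Cc

@[ext] theorem ext {f g : Cc Γ X U} (h : ∀ k x, f k x = g k x) : f = g :=
  Subtype.ext (funext fun k => funext fun x => h k x)

@[simp] theorem add_apply (f g : Cc Γ X U) (k : Γ) (x : X) : (f + g) k x = f k x + g k x := rfl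
@[simp] theorem zero_apply (k : Γ) (x : X) : (0 : Cc Γ X U) k x = 0 := rfl
@[simp] theorem neg_apply (f : Cc Γ X U) (k : Γ) (x : X) : (-f) k x = -f k x := rfl
@[simp] theorem smul_apply (c : ℂ) (f : Cc Γ X U) (k : Γ) (x : X) :
    (c • f) k x = c * f k x := rfl

/-- The finite set of group elements over which `f` does not vanish identically. -/
def supp (f : Cc Γ X U) : Finset Γ := f.2.1.toFinset

theorem eq_zero_of_notMem (f : Cc Γ X U) {k : Γ} (hk : k ∉ f.supp) : f k = 0 := by
  simpa [supp] using hk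

theorem mem_arrows (f : Cc Γ X U) {k : Γ} {x : X} (h : f k x ≠ 0) : x ∈ arrows U k :=
  (f.2.2 k).2.2 (subset_tsupport _ h)

end Cc

/-- Left convolution by `f` along the orbit of `x`:
`(k, x) ↦ ∑ f(γ₁) u(γ₂)` over the factorisations `(k, x) = γ₁ γ₂ = (k s⁻¹, s x) (s, x)`. -/
def act (f : Γ → X → ℂ) (x : X) (u : Γ → ℂ) (k : Γ) : ℂ :=
  ∑ᶠ s : Γ, f (k * s⁻¹) (s • x) * u s

namespace Cc

theorem act_eq_sum (f : Cc Γ X U) {S : Finset Γ} (hS : f.supp ⊆ S) (x : X) (u : Γ → ℂ) (k : Γ) :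
    act f x u k = ∑ g ∈ S, f g ((g⁻¹ * k) • x) * u (g⁻¹ * k) := by
  unfold act
  let e : Γ ≃ Γ := (Equiv.inv Γ).trans (Equiv.mulRight k)
  rw [← finsum_comp_equiv e]
  have he : ∀ g, e g = g⁻¹ * k := fun g => rfl
  simp only [he, mul_inv_rev, inv_inv, mul_inv_cancel_left]
  refine finsum_eq_sum_of_support_subset _ fun g hg => ?_
  by_contra h
  exact hg (by simp [f.eq_zero_of_notMem (fun h' => h (hS h'))])

theorem act_add_right (f : Cc Γ X U) (x : X) (u v : Γ → ℂ) (k : Γ) :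
    act f x (u + v) k = act f x u k + act f x v k := by
  simp only [f.act_eq_sum (le_refl _), ← Finset.sum_add_distrib, Pi.add_apply, mul_add]

theorem act_smul_right (f : Cc Γ X U) (c : ℂ) (x : X) (u : Γ → ℂ) (k : Γ) :
    act f x (c • u) k = c * act f x u k := by
  simp only [f.act_eq_sum (le_refl _), Finset.mul_sum, Pi.smul_apply, smul_eq_mul]
  exact Finset.sum_congr rfl fun _ _ => by ring

theorem act_add_left (f g : Cc Γ X U) (x : X) (u : Γ → ℂ) (k : Γ) :
    act (f + g : Cc Γ X U) x u k = act f x u k + act g x u k := by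
  classical
  rw [(f + g).act_eq_sum (S := f.supp ∪ g.supp ∪ (f + g).supp) (by intro; simp_all),
    f.act_eq_sum (S := f.supp ∪ g.supp ∪ (f + g).supp) (by intro; simp_all),
    g.act_eq_sum (S := f.supp ∪ g.supp ∪ (f + g).supp) (by intro; simp_all),
    ← Finset.sum_add_distrib]
  exact Finset.sum_congr rfl fun _ _ => by rw [add_apply]; ring

theorem act_smul_left (c : ℂ) (f : Cc Γ X U) (x : X) (u : Γ → ℂ) (k : Γ) :
    act (c • f : Cc Γ X U) x u k = c * act f x u k := by
  classical
  rw [(c • f).act_eq_sum (S := f.supp ∪ (c • f).supp) (by intro; simp_all),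
    f.act_eq_sum (S := f.supp ∪ (c • f).supp) (by intro; simp_all), Finset.mul_sum]
  exact Finset.sum_congr rfl fun _ _ => by rw [smul_apply]; ring

theorem act_eq_zero (f : Cc Γ X U) (x : X) (u : Γ → ℂ) {k : Γ} (hk : k • x ∉ U) :
    act f x u k = 0 := by
  rw [f.act_eq_sum (le_refl _)]
  refine Finset.sum_eq_zero fun g _ => ?_
  by_cases h : f g ((g⁻¹ * k) • x) = 0
  · simp [h]
  · exact absurd (f.mem_arrows h).2 (by simpa [smul_smul] using hk)

variable [ContinuousConstSMul Γ X]

theorem conv_mem (f g : Cc Γ X U) :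
    (fun k x => act f x (fun s => g s x) k) ∈ ccSubmodule Γ X U := by
  classical
  have key : ∀ k, (fun x => act f x (fun s => g s x) k) =
      ∑ a ∈ f.supp, fun x => f a ((a⁻¹ * k) • x) * g (a⁻¹ * k) x := by
    intro k
    funext x
    rw [f.act_eq_sum (le_refl _), Finset.sum_apply]
  have hterm : ∀ k a, Continuous (fun x => f a ((a⁻¹ * k) • x) * g (a⁻¹ * k) x) ∧
      HasCompactSupport (fun x => f a ((a⁻¹ * k) • x) * g (a⁻¹ * k) x) ∧
      tsupport (fun x => f a ((a⁻¹ * k) • x) * g (a⁻¹ * k) x) ⊆ arrows U k := by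
    intro k a
    refine ⟨((f.2.2 a).1.comp (continuous_const_smul _)).mul (g.2.2 _).1,
      (g.2.2 _).2.1.mul_left, fun x hx => ?_⟩
    have h1 : x ∈ tsupport (g (a⁻¹ * k)) := tsupport_mul_subset_right hx
    have h2 : x ∈ tsupport (fun x => f a ((a⁻¹ * k) • x)) := tsupport_mul_subset_left hx
    have h3 : (a⁻¹ * k) • x ∈ tsupport (f a) := by
      have := tsupport_comp_subset_preimage (f a) (continuous_const_smul (T := X) (a⁻¹ * k)) h2
      exact this
    refine ⟨((g.2.2 _).2.2 h1).1, ?_⟩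
    have := ((f.2.2 a).2.2 h3).2
    simpa [smul_smul] using this
  refine ⟨(Finset.finite_toSet (Finset.image₂ (· * ·) f.supp g.supp)).subset ?_, fun k => ?_⟩
  · intro k hk
    by_contra h
    apply hk
    simp only [key]
    refine Finset.sum_eq_zero fun a ha => ?_
    have : a⁻¹ * k ∉ g.supp := fun hg => h (by
      simp only [Finset.coe_image₂, Set.mem_image2, Finset.mem_coe]
      exact ⟨a, ha, a⁻¹ * k, hg, by simp⟩)
    funext x
    simp [g.eq_zero_of_notMem this]
  · have h : (fun x => act f x (fun s => g s x) k) ∈ {φ : X → ℂ | Continuous φ ∧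
        HasCompactSupport φ ∧ tsupport φ ⊆ arrows U k} := by
      rw [key]
      refine Finset.sum_induction _ (· ∈ {φ : X → ℂ | Continuous φ ∧
        HasCompactSupport φ ∧ tsupport φ ⊆ arrows U k}) ?_ ?_ (fun a _ => hterm k a)
      · rintro φ ψ ⟨h1, h2, h3⟩ ⟨h1', h2', h3'⟩
        exact ⟨h1.add h1', h2.add h2', (tsupport_add φ ψ).trans (Set.union_subset h3 h3')⟩
      · exact ⟨continuous_const, HasCompactSupport.zero, by simp [tsupport]⟩
    exact h

/-- The convolution product `(f * g)(k, x) = ∑ₛ f(k s⁻¹, s x) g(s, x)`. -/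
instance : Mul (Cc Γ X U) := ⟨fun f g => ⟨fun k x => act f x (fun s => g s x) k, conv_mem f g⟩⟩

theorem mul_apply (f g : Cc Γ X U) (k : Γ) (x : X) :
    (f * g) k x = act f x (fun s => g s x) k := rfl

theorem act_mul (f g : Cc Γ X U) (x : X) (u : Γ → ℂ) (k : Γ) :
    act (f * g : Cc Γ X U) x u k = act f x (act g x u) k := by
  rw [f.act_eq_sum (le_refl _)]
  have h1 : ∀ s, (f * g) (k * s⁻¹) (s • x) * u s =
      ∑ a ∈ f.supp, f a ((a⁻¹ * k) • x) * (g (a⁻¹ * k * s⁻¹) (s • x) * u s) := by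
    intro s
    rw [mul_apply, f.act_eq_sum (le_refl _), Finset.sum_mul]
    refine Finset.sum_congr rfl fun a _ => ?_
    rw [smul_smul]
    simp only [mul_assoc, inv_mul_cancel, mul_one]
  unfold act
  simp only [h1]
  rw [finsum_sum_comm]
  · refine Finset.sum_congr rfl fun a _ => ?_
    rw [← mul_finsum]
  · intro a _
    have hfin := (g.supp.finite_toSet).preimage
      (f := fun s : Γ => a⁻¹ * k * s⁻¹) (by intro s _ t _ h; simpa using h)
    refine hfin.subset fun s hs => ?_
    by_contra h
    exact hs (by simp [g.eq_zero_of_notMem h])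

theorem star_mem (f : Cc Γ X U) :
    (fun k x => conj (f k⁻¹ (k • x))) ∈ ccSubmodule Γ X U := by
  refine ⟨?_, fun k => ⟨?_, ?_, ?_⟩⟩
  · refine ((f.supp.finite_toSet).preimage (f := fun k : Γ => k⁻¹) inv_injective.injOn).subset
      fun k hk => ?_
    by_contra h
    exact hk (by funext x; simp [f.eq_zero_of_notMem h])
  · exact Complex.continuous_conj.comp ((f.2.2 k⁻¹).1.comp (continuous_const_smul k))
  · exact ((f.2.2 k⁻¹).2.1.comp_homeomorph (Homeomorph.smul k)).comp_left (map_zero _)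
  · intro x hx
    have h1 : x ∈ tsupport (fun x => f k⁻¹ (k • x)) :=
      tsupport_comp_subset (map_zero (starRingEnd ℂ)) (fun x => f k⁻¹ (k • x)) hx
    have h2 := tsupport_comp_subset_preimage (f k⁻¹) (continuous_const_smul (T := X) k) h1
    have h3 := (f.2.2 k⁻¹).2.2 h2
    exact ⟨by simpa using h3.2, h3.1⟩

/-- The involution `f*(k, x) = conj f(k⁻¹, k x)`. -/
instance : Star (Cc Γ X U) := ⟨fun f => ⟨fun k x => conj (f k⁻¹ (k • x)), star_mem f⟩⟩

theorem star_apply (f : Cc Γ X U) (k : Γ) (x : X) : (star f) k x = conj (f k⁻¹ (k • x)) := rfl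

instance : NonUnitalRing (Cc Γ X U) where
  left_distrib f g h := by ext k x; exact f.act_add_right x _ _ k
  right_distrib f g h := by ext k x; exact f.act_add_left g x _ k
  zero_mul f := by
    ext k x
    have := act_smul_left 0 (0 : Cc Γ X U) x (fun s => f s x) k
    rw [zero_smul, zero_mul] at this
    exact this
  mul_zero f := by
    ext k x
    have := f.act_smul_right 0 x 0 k
    rw [zero_smul, zero_mul] at this
    exact this
  mul_assoc f g h := by ext k x; exact act_mul f g x _ k

instance : IsScalarTower ℂ (Cc Γ X U) (Cc Γ X U) :=
  ⟨fun c f g => by ext k x; exact act_smul_left c f x _ k⟩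

instance : SMulCommClass ℂ (Cc Γ X U) (Cc Γ X U) :=
  ⟨fun c f g => by ext k x; exact (f.act_smul_right c x _ k).symm⟩

instance : StarRing (Cc Γ X U) where
  star_involutive f := by ext k x; simp [star_apply, smul_smul]
  star_add f g := by ext k x; simp [star_apply]
  star_mul f g := by
    ext k x
    rw [star_apply, mul_apply, mul_apply]
    unfold act
    rw [← finsum_comp_equiv (Equiv.mulRight k⁻¹)]
    have hfin : (fun s => f (k⁻¹ * (s * k⁻¹)⁻¹) ((s * k⁻¹) • k • x) *
        g (s * k⁻¹) (k • x)).support.Finite := by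
      refine ((g.supp.finite_toSet).preimage (f := fun s : Γ => s * k⁻¹)
        (mul_left_injective _).injOn).subset fun s hs => ?_
      by_contra h
      exact hs (by simp [g.eq_zero_of_notMem h])
    have := AddMonoidHom.map_finsum (starRingEnd ℂ : ℂ →+* ℂ).toAddMonoidHom hfin
    refine this.trans (finsum_congr fun s => ?_)
    simp [star_apply, smul_smul, mul_comm]

instance : StarModule ℂ (Cc Γ X U) := ⟨fun c f => by ext k x; simp [star_apply]⟩

/-- The norm of `ℓ¹(Γ, C₀(X))`: `∑ₖ supₓ |f(k, x)|`. -/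
def ellOne (f : Cc Γ X U) : ℝ := ∑ k ∈ f.supp, ⨆ x, ‖f k x‖

theorem bddAbove_norm (f : Cc Γ X U) (k : Γ) : BddAbove (Set.range fun x => ‖f k x‖) := by
  obtain ⟨C, hC⟩ := (f.2.2 k).2.1.exists_bound_of_continuous (f.2.2 k).1
  exact ⟨C, by rintro _ ⟨x, rfl⟩; exact hC x⟩

theorem norm_le_iSup (f : Cc Γ X U) (k : Γ) (x : X) : ‖f k x‖ ≤ ⨆ x, ‖f k x‖ :=
  le_ciSup (f.bddAbove_norm k) x

theorem iSup_nonneg (f : Cc Γ X U) (k : Γ) : 0 ≤ ⨆ x, ‖f k x‖ :=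
  Real.iSup_nonneg fun _ => norm_nonneg _

theorem ellOne_nonneg (f : Cc Γ X U) : 0 ≤ f.ellOne :=
  Finset.sum_nonneg fun k _ => f.iSup_nonneg k

/-- The C⋆-seminorms on the involutive algebra `C_c(G)`. The bound by the `ℓ¹`-norm is the usual
boundedness requirement on the representations of `C_c(G)` that define the full C⋆-norm (for the
groupoids considered here every C⋆-seminorm on `C_c(G)` satisfies it). -/
structure IsCStarSeminorm (q : Seminorm ℂ (Cc Γ X U)) : Prop where
  mul_le : ∀ f g, q (f * g) ≤ q f * q g
  star_mul_self : ∀ f, q (star f * f) = q f ^ 2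
  le_ellOne : ∀ f, q f ≤ f.ellOne

theorem isCStarSeminorm_zero : IsCStarSeminorm (0 : Seminorm ℂ (Cc Γ X U)) :=
  ⟨fun _ _ => by simp, fun _ => by simp, fun f => f.ellOne_nonneg⟩

instance : Nonempty {q : Seminorm ℂ (Cc Γ X U) // IsCStarSeminorm q} :=
  ⟨⟨0, isCStarSeminorm_zero⟩⟩

/-- The full C⋆-norm on `C_c(G)`: the largest C⋆-seminorm. -/
def fullNorm (f : Cc Γ X U) : ℝ := ⨆ q : {q : Seminorm ℂ (Cc Γ X U) // IsCStarSeminorm q}, q.1 f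

theorem bddAbove_fullNorm (f : Cc Γ X U) :
    BddAbove (Set.range fun q : {q : Seminorm ℂ (Cc Γ X U) // IsCStarSeminorm q} => q.1 f) :=
  ⟨f.ellOne, by rintro _ ⟨q, rfl⟩; exact q.2.le_ellOne f⟩

theorem le_fullNorm {q : Seminorm ℂ (Cc Γ X U)} (hq : IsCStarSeminorm q) (f : Cc Γ X U) :
    q f ≤ f.fullNorm :=
  le_ciSup f.bddAbove_fullNorm ⟨q, hq⟩

theorem fullNorm_le {f : Cc Γ X U} {C : ℝ}
    (h : ∀ q : Seminorm ℂ (Cc Γ X U), IsCStarSeminorm q → q f ≤ C) : f.fullNorm ≤ C :=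
  ciSup_le fun q => h q.1 q.2

theorem fullNorm_nonneg (f : Cc Γ X U) : 0 ≤ f.fullNorm :=
  (apply_nonneg _ f).trans (le_fullNorm isCStarSeminorm_zero f)

theorem fullNorm_le_ellOne (f : Cc Γ X U) : f.fullNorm ≤ f.ellOne :=
  fullNorm_le fun _ hq => hq.le_ellOne f

theorem IsCStarSeminorm.star_le {q : Seminorm ℂ (Cc Γ X U)} (hq : IsCStarSeminorm q)
    (f : Cc Γ X U) : q (star f) ≤ q f := by
  have h1 := hq.star_mul_self (star f)
  have h2 := hq.mul_le (star (star f)) (star f)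
  rw [h1, star_star, pow_two] at h2
  rcases (apply_nonneg q (star f)).eq_or_lt with h | h
  · rw [← h]; exact apply_nonneg q f
  · exact le_of_mul_le_mul_right h2 h

theorem fullNorm_mul_le (f g : Cc Γ X U) : (f * g).fullNorm ≤ f.fullNorm * g.fullNorm :=
  fullNorm_le fun _ hq => (hq.mul_le f g).trans
    (mul_le_mul (le_fullNorm hq f) (le_fullNorm hq g) (apply_nonneg _ _) f.fullNorm_nonneg)

theorem fullNorm_star_le (f : Cc Γ X U) : (star f).fullNorm ≤ f.fullNorm :=
  fullNorm_le fun _ hq => (hq.star_le f).trans (le_fullNorm hq f)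

theorem fullNorm_star (f : Cc Γ X U) : (star f).fullNorm = f.fullNorm :=
  le_antisymm f.fullNorm_star_le (by simpa using (star f).fullNorm_star_le)

theorem sq_fullNorm_le (f : Cc Γ X U) : f.fullNorm * f.fullNorm ≤ (star f * f).fullNorm := by
  rw [← pow_two]
  refine (Real.le_sqrt f.fullNorm_nonneg (star f * f).fullNorm_nonneg).mp
    (fullNorm_le fun q hq => Real.le_sqrt_of_sq_le ?_)
  rw [← hq.star_mul_self]
  exact le_fullNorm hq _

/-- The full C⋆-norm as a seminorm. -/
def fullSeminorm : Seminorm ℂ (Cc Γ X U) :=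
  Seminorm.ofSMulLE fullNorm
    (le_antisymm (fullNorm_le fun q _ => by simp) (fullNorm_nonneg 0))
    (fun f g => fullNorm_le fun q hq => (map_add_le_add q f g).trans
      (add_le_add (le_fullNorm hq f) (le_fullNorm hq g)))
    (fun c f => fullNorm_le fun q hq => by
      rw [map_smul_eq_mul]
      exact mul_le_mul_of_nonneg_left (le_fullNorm hq f) (norm_nonneg c))

instance : SeminormedAddCommGroup (Cc Γ X U) :=
  (fullSeminorm (Γ := Γ) (X := X) (U := U)).toAddGroupSeminorm.toSeminormedAddCommGroup

theorem norm_def (f : Cc Γ X U) : ‖f‖ = f.fullNorm := rfl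

instance : NormedSpace ℂ (Cc Γ X U) where
  norm_smul_le c f := (map_smul_eq_mul (fullSeminorm (Γ := Γ) (X := X) (U := U)) c f).le

instance : NonUnitalSeminormedRing (Cc Γ X U) where
  __ := (inferInstance : SeminormedAddCommGroup (Cc Γ X U))
  __ := (inferInstance : NonUnitalRing (Cc Γ X U))
  norm_mul_le f g := fullNorm_mul_le f g

instance : NormedStarGroup (Cc Γ X U) := ⟨fun f => f.fullNorm_star_le⟩

end Cc

variable (Γ X U)
variable [ContinuousConstSMul Γ X]

/-- The (full) C⋆-algebra `C⋆(G)` of the reduced groupoid. -/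
def CStar : Type := UniformSpace.Completion (Cc Γ X U)

namespace CStar

open UniformSpace

instance : NormedAddCommGroup (CStar Γ X U) :=
  inferInstanceAs (NormedAddCommGroup (Completion (Cc Γ X U)))
instance : NormedSpace ℂ (CStar Γ X U) :=
  inferInstanceAs (NormedSpace ℂ (Completion (Cc Γ X U)))
instance : CompleteSpace (CStar Γ X U) :=
  inferInstanceAs (CompleteSpace (Completion (Cc Γ X U)))

variable {Γ X U}

/-- The canonical map `C_c(G) → C⋆(G)`. -/
def of (f : Cc Γ X U) : CStar Γ X U := (f : Completion (Cc Γ X U))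

theorem isDenseInducing_of : IsDenseInducing (of : Cc Γ X U → CStar Γ X U) :=
  Completion.isDenseInducing_coe

theorem continuous_of : Continuous (of : Cc Γ X U → CStar Γ X U) :=
  Completion.continuous_coe _

theorem of_add (f g : Cc Γ X U) : of (f + g) = of f + of g := Completion.coe_add f g
theorem of_zero : of (0 : Cc Γ X U) = 0 := Completion.coe_zero
theorem of_smul (c : ℂ) (f : Cc Γ X U) : of (c • f) = c • of f := Completion.coe_smul c f
theorem norm_of (f : Cc Γ X U) : ‖of f‖ = f.fullNorm := Completion.norm_coe f

@[elab_as_elim]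
theorem induction_on {P : CStar Γ X U → Prop} (a : CStar Γ X U) (hc : IsClosed {a | P a})
    (h : ∀ f, P (of f)) : P a :=
  Completion.induction_on a hc h

@[elab_as_elim]
theorem induction_on₂ {P : CStar Γ X U → CStar Γ X U → Prop} (a b : CStar Γ X U)
    (hc : IsClosed {x : CStar Γ X U × CStar Γ X U | P x.1 x.2}) (h : ∀ f g, P (of f) (of g)) :
    P a b :=
  Completion.induction_on₂ a b hc h

@[elab_as_elim]
theorem induction_on₃ {P : CStar Γ X U → CStar Γ X U → CStar Γ X U → Prop} (a b c : CStar Γ X U)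
    (hc : IsClosed {x : CStar Γ X U × CStar Γ X U × CStar Γ X U | P x.1 x.2.1 x.2.2})
    (h : ∀ f g e, P (of f) (of g) (of e)) : P a b c :=
  Completion.induction_on₃ a b c hc h

/-- The product is the continuous extension of convolution. -/
instance : Mul (CStar Γ X U) :=
  ⟨Function.curry <| (isDenseInducing_of.prodMap isDenseInducing_of).extend
    (of ∘ Function.uncurry (· * ·))⟩

theorem of_mul (f g : Cc Γ X U) : of (f * g) = of f * of g :=
  ((isDenseInducing_of.prodMap isDenseInducing_of).extend_eq
      (continuous_of.comp (continuous_mul (M := Cc Γ X U))) (f, g)).symm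

instance : ContinuousMul (CStar Γ X U) where
  continuous_mul := by
    let e : Cc Γ X U →+ CStar Γ X U := ⟨⟨of, of_zero⟩, of_add⟩
    let m := (AddMonoidHom.mul : Cc Γ X U →+ Cc Γ X U →+ Cc Γ X U).compr₂ e
    have : Continuous fun p : Cc Γ X U × Cc Γ X U => m p.1 p.2 :=
      continuous_of.comp continuous_mul
    have di : IsDenseInducing e := isDenseInducing_of
    exact (di.extend_Z_bilin di this :)

instance : NonUnitalNormedRing (CStar Γ X U) where
  __ := (inferInstance : NormedAddCommGroup (CStar Γ X U))
  left_distrib a b c := by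
    refine induction_on₃ a b c (isClosed_eq (by fun_prop) (by fun_prop)) fun f g h => ?_
    rw [← of_add, ← of_mul, ← of_mul, ← of_mul, ← of_add, mul_add]
  right_distrib a b c := by
    refine induction_on₃ a b c (isClosed_eq (by fun_prop) (by fun_prop)) fun f g h => ?_
    rw [← of_add, ← of_mul, ← of_mul, ← of_mul, ← of_add, add_mul]
  zero_mul a := by
    refine induction_on a (isClosed_eq (by fun_prop) (by fun_prop)) fun f => ?_
    rw [← of_zero, ← of_mul, zero_mul]
  mul_zero a := by
    refine induction_on a (isClosed_eq (by fun_prop) (by fun_prop)) fun f => ?_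
    rw [← of_zero, ← of_mul, mul_zero]
  mul_assoc a b c := by
    refine induction_on₃ a b c (isClosed_eq (by fun_prop) (by fun_prop)) fun f g h => ?_
    rw [← of_mul, ← of_mul, ← of_mul, ← of_mul, mul_assoc]
  norm_mul_le a b := by
    refine induction_on₂ a b (isClosed_le (by fun_prop) (by fun_prop)) fun f g => ?_
    rw [← of_mul, norm_of, norm_of, norm_of]
    exact f.fullNorm_mul_le g

/-- The involution is the continuous extension of the involution of `C_c(G)`. -/
instance : Star (CStar Γ X U) := ⟨Completion.map star⟩

theorem uniformContinuous_star : UniformContinuous (star : Cc Γ X U → Cc Γ X U) :=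
  uniformContinuous_addMonoidHom_of_continuous
    (f := (starAddEquiv : Cc Γ X U ≃+ Cc Γ X U).toAddMonoidHom) continuous_star

theorem of_star (f : Cc Γ X U) : of (star f) = star (of f) :=
  (Completion.map_coe uniformContinuous_star f).symm

theorem continuous_star' : Continuous (star : CStar Γ X U → CStar Γ X U) :=
  Completion.continuous_map

instance : StarRing (CStar Γ X U) where
  star_involutive a := by
    refine induction_on a (isClosed_eq (continuous_star'.comp continuous_star') continuous_id)
      fun f => ?_
    rw [← of_star, ← of_star, star_star]
  star_add a b := by
    refine induction_on₂ a b (isClosed_eq (continuous_star'.comp (by fun_prop))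
      ((continuous_star'.comp continuous_fst).add (continuous_star'.comp continuous_snd)))
      fun f g => ?_
    rw [← of_add, ← of_star, ← of_star, ← of_star, ← of_add, star_add]
  star_mul a b := by
    refine induction_on₂ a b (isClosed_eq (continuous_star'.comp (by fun_prop))
      ((continuous_star'.comp continuous_snd).mul (continuous_star'.comp continuous_fst)))
      fun f g => ?_
    rw [← of_mul, ← of_star, ← of_star, ← of_star, ← of_mul, star_mul]

theorem continuous_smul_left (c : ℂ) : Continuous (fun a : CStar Γ X U => c • a) :=
  continuous_const_smul c

instance : NonUnitalCStarAlgebra (CStar Γ X U) where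
  norm_mul_self_le a := by
    refine induction_on a (isClosed_le (by fun_prop)
      (continuous_norm.comp (continuous_star'.mul continuous_id))) fun f => ?_
    rw [← of_star, ← of_mul, norm_of, norm_of]
    exact f.sq_fullNorm_le
  smul_assoc c a b := by
    refine induction_on₂ a b (isClosed_eq
      (((continuous_smul_left c).comp continuous_fst).mul continuous_snd)
      ((continuous_smul_left c).comp continuous_mul)) fun f g => ?_
    simp only [smul_eq_mul]
    rw [← of_smul, ← of_mul, ← of_mul, ← of_smul, smul_mul_assoc]
  smul_comm c a b := by
    refine induction_on₂ a b (isClosed_eq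
      ((continuous_smul_left c).comp continuous_mul)
      (continuous_fst.mul ((continuous_smul_left c).comp continuous_snd))) fun f g => ?_
    simp only [smul_eq_mul]
    rw [← of_smul, ← of_mul, ← of_mul, ← of_smul, mul_smul_comm]
  star_smul c a := by
    refine induction_on a (isClosed_eq (continuous_star'.comp (continuous_smul_left c))
      ((continuous_smul_left _).comp continuous_star')) fun f => ?_
    rw [← of_smul, ← of_star, ← of_star, ← of_smul, star_smul]

/-- A ⋆-homomorphism on `C_c(G)` that is bounded by the `ℓ¹`-norm is contractive for the full
C⋆-norm. -/
theorem norm_le_fullNorm {B : Type} [NonUnitalCStarAlgebra B] (φ : Cc Γ X U →⋆ₙₐ[ℂ] B)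
    (h : ∀ f, ‖φ f‖ ≤ f.ellOne) (f : Cc Γ X U) : ‖φ f‖ ≤ f.fullNorm := by
  let q : Seminorm ℂ (Cc Γ X U) := Seminorm.ofSMulLE (fun f => ‖φ f‖) (by simp)
    (fun f g => by simpa using norm_add_le (φ f) (φ g)) (fun c f => by simp [norm_smul])
  have hq : Cc.IsCStarSeminorm q :=
    ⟨fun f g => by
        change ‖φ (f * g)‖ ≤ ‖φ f‖ * ‖φ g‖
        rw [map_mul]
        exact norm_mul_le _ _,
      fun f => by
        change ‖φ (star f * f)‖ = ‖φ f‖ ^ 2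
        rw [map_mul, map_star, CStarRing.norm_star_mul_self, pow_two], h⟩
  exact Cc.le_fullNorm hq f

/-- The continuous extension to `C⋆(G)` of a ⋆-homomorphism on `C_c(G)`. -/
def lift {B : Type} [NonUnitalCStarAlgebra B] (φ : Cc Γ X U →⋆ₙₐ[ℂ] B)
    (h : ∀ f, ‖φ f‖ ≤ f.ellOne) : CStar Γ X U →⋆ₙₐ[ℂ] B :=
  have hu : UniformContinuous φ := by
    refine AddMonoidHomClass.uniformContinuous_of_bound φ 1 fun f => ?_
    rw [one_mul]
    exact norm_le_fullNorm φ h f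
  have he : ∀ f, Completion.extension φ (of f) = φ f := Completion.extension_coe hu
  have hc : Continuous (Completion.extension φ : CStar Γ X U → B) := Completion.continuous_extension
  { toFun := Completion.extension φ
    map_zero' := by rw [← of_zero, he, map_zero]
    map_add' := fun a b => by
      refine induction_on₂ a b (isClosed_eq (by fun_prop) (by fun_prop)) fun f g => ?_
      rw [← of_add, he, he, he, map_add]
    map_mul' := fun a b => by
      refine induction_on₂ a b (isClosed_eq (by fun_prop) (by fun_prop)) fun f g => ?_
      rw [← of_mul, he, he, he, map_mul]
    map_smul' := fun c a => by
      refine induction_on a (isClosed_eq (hc.comp (continuous_smul_left c)) (hc.const_smul c))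
        fun f => ?_
      rw [← of_smul, he, he]
      exact map_smul φ c f
    map_star' := fun a => by
      refine induction_on a (isClosed_eq (hc.comp continuous_star') hc.star) fun f => ?_
      rw [← of_star, he, he, map_star] }

theorem lift_of {B : Type} [NonUnitalCStarAlgebra B] (φ : Cc Γ X U →⋆ₙₐ[ℂ] B)
    (h : ∀ f, ‖φ f‖ ≤ f.ellOne) (f : Cc Γ X U) : lift φ h (of f) = φ f := by
  have hu : UniformContinuous φ := by
    refine AddMonoidHomClass.uniformContinuous_of_bound φ 1 fun f => ?_
    rw [one_mul]
    exact norm_le_fullNorm φ h f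
  exact Completion.extension_coe hu f

end CStar
end Groupoid

/-- The Hilbert space `ℓ²(ι)`. -/
abbrev EllTwo (ι : Type) : Type := lp (fun _ : ι => ℂ) 2

/-- The arrows of the groupoid with source `y`, identified with the `k` such that `k • y ∈ U`. -/
abbrev Fiber {X : Type} (U : Set X) (Γ : Type) [Group Γ] [MulAction Γ X] (y : X) : Type :=
  {k : Γ // k • y ∈ U}

section Representations

variable {Γ X : Type} [Group Γ] [TopologicalSpace X] [MulAction Γ X] {U : Set X}

/-! ### Time evolutions given by characters of `Γ` -/

variable [ContinuousConstSMul Γ X]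

namespace Cc

theorem twist_mem (χ : Γ →* Circle) (f : Cc Γ X U) :
    (fun k x => (χ k : ℂ) * f k x) ∈ ccSubmodule Γ X U := by
  refine ⟨f.2.1.subset fun k hk h => hk ?_, fun k => ⟨continuous_const.mul (f.2.2 k).1,
    (f.2.2 k).2.1.mul_left, ?_⟩⟩
  · funext x
    simp [h]
  · exact (tsupport_mul_subset_right (f := fun _ => (χ k : ℂ))).trans (f.2.2 k).2.2

/-- The ⋆-endomorphism `f(k, x) ↦ χ(k) f(k, x)` of `C_c(G)`. -/
def twist (χ : Γ →* Circle) : Cc Γ X U →⋆ₙₐ[ℂ] Cc Γ X U where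
  toFun f := ⟨fun k x => (χ k : ℂ) * f k x, twist_mem χ f⟩
  map_smul' c f := by
    ext k x
    change (χ k : ℂ) * (c * f k x) = c * ((χ k : ℂ) * f k x)
    ring
  map_zero' := by
    ext k x
    exact mul_zero _
  map_add' f g := by
    ext k x
    exact mul_add _ _ _
  map_mul' f g := by
    ext k x
    change (χ k : ℂ) * act f x (fun s => g s x) k =
      ∑ᶠ s, ((χ (k * s⁻¹) : ℂ) * f (k * s⁻¹) (s • x)) * ((χ s : ℂ) * g s x)
    unfold act
    rw [← smul_eq_mul, smul_finsum]
    refine finsum_congr fun s => ?_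
    have : (χ k : ℂ) = χ (k * s⁻¹) * χ s := by rw [← Circle.coe_mul, ← map_mul]; simp
    rw [this, smul_eq_mul]
    ring
  map_star' f := by
    ext k x
    change (χ k : ℂ) * conj (f k⁻¹ (k • x)) = conj ((χ k⁻¹ : ℂ) * f k⁻¹ (k • x))
    rw [map_mul, map_inv, Circle.coe_inv_eq_conj, Complex.conj_conj]

theorem ellOne_le {f : Cc Γ X U} {S : Finset Γ} {C : Γ → ℝ} (hS : f.supp ⊆ S)
    (hC : ∀ k, 0 ≤ C k) (h : ∀ k x, ‖f k x‖ ≤ C k) : f.ellOne ≤ ∑ k ∈ S, C k :=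
  (Finset.sum_le_sum fun k _ => Real.iSup_le (h k) (hC k)).trans
    (Finset.sum_le_sum_of_subset_of_nonneg hS fun k _ _ => hC k)

theorem ellOne_twist_le (χ : Γ →* Circle) (f : Cc Γ X U) : (twist χ f).ellOne ≤ f.ellOne := by
  refine ellOne_le (fun k hk => ?_) f.iSup_nonneg fun k x => ?_
  · by_contra h
    have h0 : twist χ f k = 0 := by
      funext x
      change (χ k : ℂ) * f k x = 0
      simp [f.eq_zero_of_notMem h]
    simp [supp, h0] at hk
  · change ‖(χ k : ℂ) * f k x‖ ≤ _
    rw [norm_mul, Circle.norm_coe, one_mul]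
    exact f.norm_le_iSup k x

end Cc

namespace CStar

/-- The canonical map `C_c(G) → C⋆(G)` as a ⋆-homomorphism. -/
def ofHom : Cc Γ X U →⋆ₙₐ[ℂ] CStar Γ X U where
  toFun := of
  map_smul' := of_smul
  map_zero' := of_zero
  map_add' := of_add
  map_mul' := of_mul
  map_star' := of_star

theorem norm_ofHom_twist_le (χ : Γ →* Circle) (f : Cc Γ X U) :
    ‖((ofHom : Cc Γ X U →⋆ₙₐ[ℂ] CStar Γ X U).comp (Cc.twist χ)) f‖ ≤ f.ellOne := by
  change ‖of (Cc.twist χ f)‖ ≤ f.ellOne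
  rw [norm_of]
  exact (Cc.fullNorm_le_ellOne _).trans (Cc.ellOne_twist_le χ f)

/-- The ⋆-endomorphism of `C⋆(G)` that extends `f(k, x) ↦ χ(k) f(k, x)`. -/
def twist (χ : Γ →* Circle) : CStar Γ X U →⋆ₙₐ[ℂ] CStar Γ X U :=
  lift (ofHom.comp (Cc.twist χ)) (norm_ofHom_twist_le χ)

theorem twist_of (χ : Γ →* Circle) (f : Cc Γ X U) : twist χ (of f) = of (Cc.twist χ f) :=
  lift_of (ofHom.comp (Cc.twist χ)) (norm_ofHom_twist_le χ) f

end CStar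

/-! ### The regular representations -/

/-- Extension of a vector in `ℓ²(G_y)` by zero. -/
def extZero {y : X} (ξ : EllTwo (Fiber U Γ y)) : Γ → ℂ :=
  Function.extend Subtype.val (fun k => ξ k) 0

theorem extZero_coe {y : X} (ξ : EllTwo (Fiber U Γ y)) (k : Fiber U Γ y) : extZero ξ k = ξ k :=
  Subtype.val_injective.extend_apply _ _ _

theorem extZero_of_notMem {y : X} (ξ : EllTwo (Fiber U Γ y)) {k : Γ} (hk : k • y ∉ U) :
    extZero ξ k = 0 :=
  Function.extend_apply' _ _ _ (by rintro ⟨s, rfl⟩; exact hk s.2)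

theorem extZero_add {y : X} (ξ η : EllTwo (Fiber U Γ y)) :
    extZero (ξ + η) = extZero ξ + extZero η := by
  funext k
  by_cases hk : k • y ∈ U
  · have := fun ζ : EllTwo (Fiber U Γ y) => extZero_coe ζ ⟨k, hk⟩
    simp only at this
    simp [this]
  · simp [extZero_of_notMem _ hk]

theorem extZero_smul {y : X} (c : ℂ) (ξ : EllTwo (Fiber U Γ y)) :
    extZero (c • ξ) = c • extZero ξ := by
  funext k
  by_cases hk : k • y ∈ U
  · have := fun ζ : EllTwo (Fiber U Γ y) => extZero_coe ζ ⟨k, hk⟩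
    simp only at this
    simp [this]
  · simp [extZero_of_notMem _ hk]

theorem hasSum_sq_extZero {y : X} (ξ : EllTwo (Fiber U Γ y)) :
    HasSum (fun k => ‖extZero ξ k‖ ^ 2) (‖ξ‖ ^ 2) := by
  have h : (fun k => ‖extZero ξ k‖ ^ 2) =
      Function.extend Subtype.val (fun k : Fiber U Γ y => ‖ξ k‖ ^ 2) 0 := by
    funext k
    by_cases hk : k • y ∈ U
    · rw [show k = (⟨k, hk⟩ : Fiber U Γ y).1 from rfl, Subtype.val_injective.extend_apply,
        extZero_coe]
    · rw [extZero_of_notMem _ hk, Function.extend_apply' _ _ _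
        (by rintro ⟨s, rfl⟩; exact hk s.2)]
      simp
  rw [h, hasSum_extend_zero Subtype.val_injective]
  simpa using lp.hasSum_norm (p := 2) (by simp) ξ

theorem memℓp_shift {y : X} (f : Cc Γ X U) (g : Γ) (ξ : EllTwo (Fiber U Γ y)) :
    Memℓp (fun k : Fiber U Γ y => f g ((g⁻¹ * k.1) • y) * extZero ξ (g⁻¹ * k.1)) 2 ∧
    ∀ h : Memℓp (fun k : Fiber U Γ y => f g ((g⁻¹ * k.1) • y) * extZero ξ (g⁻¹ * k.1)) 2,
      ‖(⟨_, h⟩ : EllTwo (Fiber U Γ y))‖ ≤ (⨆ x, ‖f g x‖) * ‖ξ‖ := by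
  set C := ⨆ x, ‖f g x‖
  have hinj : Function.Injective fun k : Fiber U Γ y => g⁻¹ * k.1 :=
    fun a b h => Subtype.ext (mul_left_cancel h)
  have hs : Summable fun k : Fiber U Γ y => C ^ 2 * ‖extZero ξ (g⁻¹ * k.1)‖ ^ 2 :=
    ((hasSum_sq_extZero ξ).summable.comp_injective hinj).mul_left _
  have hle : ∀ k : Fiber U Γ y, ‖f g ((g⁻¹ * k.1) • y) * extZero ξ (g⁻¹ * k.1)‖ ^ 2 ≤
      C ^ 2 * ‖extZero ξ (g⁻¹ * k.1)‖ ^ 2 := fun k => by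
    rw [norm_mul, mul_pow]
    gcongr
    exact f.norm_le_iSup g _
  have hm := Summable.of_nonneg_of_le (fun _ => by positivity) hle hs
  refine ⟨memℓp_gen (by simpa using hm), fun h => ?_⟩
  refine abs_le_of_sq_le_sq' ?_ (mul_nonneg (f.iSup_nonneg g) (norm_nonneg _)) |>.2
  have h1 := lp.hasSum_norm (p := 2) (by simp) (⟨_, h⟩ : EllTwo (Fiber U Γ y))
  have h2 : HasSum (fun k : Fiber U Γ y => ‖f g ((g⁻¹ * k.1) • y) * extZero ξ (g⁻¹ * k.1)‖ ^ 2)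
      (‖(⟨_, h⟩ : EllTwo (Fiber U Γ y))‖ ^ 2) := by simpa using h1
  rw [mul_pow, ← (hasSum_sq_extZero ξ).tsum_eq, ← tsum_mul_left, ← h2.tsum_eq]
  refine (hm.tsum_le_tsum hle hs).trans ?_
  exact tsum_comp_le_tsum_of_inj ((hasSum_sq_extZero ξ).summable.mul_left _)
    (fun _ => by positivity) hinj

theorem memℓp_act {y : X} (f : Cc Γ X U) (ξ : EllTwo (Fiber U Γ y)) :
    Memℓp (fun k : Fiber U Γ y => act f y (extZero ξ) k.1) 2 := by
  have h : (fun k : Fiber U Γ y => act f y (extZero ξ) k.1) =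
      (∑ g ∈ f.supp, (⟨_, (memℓp_shift f g ξ).1⟩ : EllTwo (Fiber U Γ y)) :
        EllTwo (Fiber U Γ y)) := by
    funext k
    rw [lp.coeFn_sum, Finset.sum_apply]
    exact f.act_eq_sum (le_refl _) y _ k.1
  rw [h]
  exact lp.memℓp _

theorem norm_act_le {y : X} (f : Cc Γ X U) (ξ : EllTwo (Fiber U Γ y)) :
    ‖(⟨_, memℓp_act f ξ⟩ : EllTwo (Fiber U Γ y))‖ ≤ f.ellOne * ‖ξ‖ := by
  have h : (⟨_, memℓp_act f ξ⟩ : EllTwo (Fiber U Γ y)) =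
      ∑ g ∈ f.supp, (⟨_, (memℓp_shift f g ξ).1⟩ : EllTwo (Fiber U Γ y)) := by
    ext k
    rw [lp.coeFn_sum, Finset.sum_apply]
    exact f.act_eq_sum (le_refl _) y _ k.1
  rw [h, Cc.ellOne, Finset.sum_mul]
  exact (norm_sum_le _ _).trans (Finset.sum_le_sum fun g _ => (memℓp_shift f g ξ).2 _)

/-- Left convolution by `f ∈ C_c(G)` on `ℓ²(G_y)`:
`(π_y(f) ξ)(γ) = ∑ f(γ₁) ξ(γ₂)` over `γ₁ γ₂ = γ`. -/
def regOp (y : X) (f : Cc Γ X U) : EllTwo (Fiber U Γ y) →L[ℂ] EllTwo (Fiber U Γ y) :=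
  LinearMap.mkContinuous
    { toFun := fun ξ => ⟨fun k => act f y (extZero ξ) k.1, memℓp_act f ξ⟩
      map_add' := fun ξ η => by
        ext k
        change act f y (extZero (ξ + η)) k.1 = act f y (extZero ξ) k.1 + act f y (extZero η) k.1
        rw [extZero_add, f.act_add_right]
      map_smul' := fun c ξ => by
        ext k
        change act f y (extZero (c • ξ)) k.1 = c * act f y (extZero ξ) k.1
        rw [extZero_smul, f.act_smul_right] }
    f.ellOne (norm_act_le f)

theorem regOp_apply (y : X) (f : Cc Γ X U) (ξ : EllTwo (Fiber U Γ y)) (k : Fiber U Γ y) :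
    regOp y f ξ k = act f y (extZero ξ) k.1 := rfl

theorem norm_regOp_le (y : X) (f : Cc Γ X U) : ‖regOp y f‖ ≤ f.ellOne :=
  LinearMap.mkContinuous_norm_le _ f.ellOne_nonneg _

theorem extZero_regOp (y : X) (f : Cc Γ X U) (ξ : EllTwo (Fiber U Γ y)) :
    extZero (regOp y f ξ) = act f y (extZero ξ) := by
  funext k
  by_cases hk : k • y ∈ U
  · exact extZero_coe (regOp y f ξ) ⟨k, hk⟩
  · rw [extZero_of_notMem _ hk, f.act_eq_zero y _ hk]

theorem hasSum_inner_extZero {y : X} (ξ η : EllTwo (Fiber U Γ y)) :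
    HasSum (fun k => conj (extZero ξ k) * extZero η k) (inner ℂ ξ η) := by
  have h : (fun k => conj (extZero ξ k) * extZero η k) =
      Function.extend Subtype.val (fun k : Fiber U Γ y => inner ℂ (ξ k) (η k)) 0 := by
    funext k
    by_cases hk : k • y ∈ U
    · rw [show k = (⟨k, hk⟩ : Fiber U Γ y).1 from rfl, Subtype.val_injective.extend_apply,
        extZero_coe, extZero_coe]
      simp [mul_comm]
    · rw [extZero_of_notMem _ hk, Function.extend_apply' _ _ _
        (by rintro ⟨s, rfl⟩; exact hk s.2)]
      simp
  rw [h, hasSum_extend_zero Subtype.val_injective]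
  exact lp.hasSum_inner ξ η

theorem regOp_star (y : X) (f : Cc Γ X U) :
    regOp y (star f) = ContinuousLinearMap.adjoint (regOp y f) := by
  rw [ContinuousLinearMap.eq_adjoint_iff]
  intro η ξ
  set u := extZero η
  set v := extZero ξ
  have hstar : ∀ k, act (star f : Cc Γ X U) y u k =
      ∑ g ∈ f.supp, conj (f g (k • y)) * u (g * k) := by
    intro k
    unfold act
    rw [← finsum_comp_equiv (Equiv.mulRight k)]
    rw [finsum_eq_sum_of_support_subset (s := f.supp)]
    · refine Finset.sum_congr rfl fun g _ => ?_
      simp [Cc.star_apply, smul_smul]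
    · intro g hg
      by_contra h
      exact hg (by simp [Cc.star_apply, f.eq_zero_of_notMem h])
  have hsum : ∀ g, Summable fun k => f g (k • y) * (conj (u (g * k)) * v k) := by
    intro g
    have h1 : Summable fun k => ‖u (g * k)‖ ^ 2 + ‖v k‖ ^ 2 :=
      ((hasSum_sq_extZero η).summable.comp_injective (mul_right_injective g)).add
        (hasSum_sq_extZero ξ).summable
    refine Summable.of_norm_bounded (h1.mul_left (⨆ x, ‖f g x‖)) fun k => ?_
    rw [norm_mul, norm_mul, RCLike.norm_conj]
    refine mul_le_mul (f.norm_le_iSup g _) ?_ (by positivity) (f.iSup_nonneg g)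
    nlinarith [sq_nonneg (‖u (g * k)‖ - ‖v k‖), sq_nonneg ‖u (g * k)‖, sq_nonneg ‖v k‖]
  have h1 : HasSum (fun k => ∑ g ∈ f.supp, f g (k • y) * (conj (u (g * k)) * v k))
      (∑ g ∈ f.supp, ∑' k, f g (k • y) * (conj (u (g * k)) * v k)) :=
    hasSum_sum fun g _ => (hsum g).hasSum
  have h2 : HasSum (fun k => ∑ g ∈ f.supp,
      f g ((g⁻¹ * k) • y) * (conj (u (g * (g⁻¹ * k))) * v (g⁻¹ * k)))
      (∑ g ∈ f.supp, ∑' k, f g (k • y) * (conj (u (g * k)) * v k)) :=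
    hasSum_sum fun g _ => by
      have h3 : HasSum ((fun k => f g (k • y) * (conj (u (g * k)) * v k)) ∘ Equiv.mulLeft g⁻¹)
          (∑' k, f g (k • y) * (conj (u (g * k)) * v k)) :=
        (Equiv.hasSum_iff _).mpr (hsum g).hasSum
      simpa only [Function.comp_def, Equiv.coe_mulLeft] using h3
  have h1' : (fun k => conj (extZero (regOp y (star f) η) k) * extZero ξ k) =
      fun k => ∑ g ∈ f.supp, f g (k • y) * (conj (u (g * k)) * v k) := by
    funext k
    rw [extZero_regOp, hstar, map_sum, Finset.sum_mul]
    refine Finset.sum_congr rfl fun g _ => ?_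
    rw [map_mul, Complex.conj_conj, mul_assoc]
  have h2' : (fun k => conj (extZero η k) * extZero (regOp y f ξ) k) =
      fun k => ∑ g ∈ f.supp,
        f g ((g⁻¹ * k) • y) * (conj (u (g * (g⁻¹ * k))) * v (g⁻¹ * k)) := by
    funext k
    rw [extZero_regOp, f.act_eq_sum (le_refl _), Finset.mul_sum]
    refine Finset.sum_congr rfl fun g _ => ?_
    rw [mul_inv_cancel_left]
    ring
  have e1 := hasSum_inner_extZero (regOp y (star f) η) ξ
  have e2 := hasSum_inner_extZero η (regOp y f ξ)
  rw [h1'] at e1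
  rw [h2'] at e2
  exact (e1.unique h1).trans (e2.unique h2).symm

/-- The representation `π_y` of `C_c(G)`. -/
def regRepCc (y : X) :
    Cc Γ X U →⋆ₙₐ[ℂ] (EllTwo (Fiber U Γ y) →L[ℂ] EllTwo (Fiber U Γ y)) where
  toFun := regOp y
  map_smul' c f := by
    ext ξ k
    exact Cc.act_smul_left c f y _ k.1
  map_zero' := by
    ext ξ k
    have := Cc.act_smul_left 0 (0 : Cc Γ X U) y (extZero ξ) k.1
    rw [zero_smul, zero_mul] at this
    exact this
  map_add' f g := by
    ext ξ k
    exact Cc.act_add_left f g y _ k.1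
  map_mul' f g := by
    ext ξ k
    change act (f * g : Cc Γ X U) y (extZero ξ) k.1 = act f y (extZero (regOp y g ξ)) k.1
    rw [Cc.act_mul, extZero_regOp]
  map_star' f := regOp_star y f

theorem regRepCc_apply (y : X) (f : Cc Γ X U) : regRepCc y f = regOp y f := rfl

theorem norm_regRepCc_le (y : X) (f : Cc Γ X U) : ‖regRepCc y f‖ ≤ f.ellOne := by
  rw [regRepCc_apply]
  exact norm_regOp_le y f

/-- The representation `π_y` of `C⋆(G)` on `ℓ²(G_y)`. -/
def regRep (y : X) :
    CStar Γ X U →⋆ₙₐ[ℂ] (EllTwo (Fiber U Γ y) →L[ℂ] EllTwo (Fiber U Γ y)) :=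
  CStar.lift (B := EllTwo (Fiber U Γ y) →L[ℂ] EllTwo (Fiber U Γ y)) (regRepCc y)
    (norm_regRepCc_le y)

theorem regRep_of (y : X) (f : Cc Γ X U) : regRep y (CStar.of f) = regOp y f :=
  CStar.lift_of (B := EllTwo (Fiber U Γ y) →L[ℂ] EllTwo (Fiber U Γ y)) (regRepCc y)
    (norm_regRepCc_le y) f

end Representations

/-! ### Unbounded operators, Hamiltonians, traces and the KMS condition -/

section Operators

variable {E : Type} [NormedAddCommGroup E] [InnerProductSpace ℂ E]

/-- The spectrum of a (possibly unbounded) operator `T`: the complement of the set of `z` for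
which `T - z` has a bounded everywhere defined two-sided inverse. -/
def unboundedSpectrum (T : E →ₗ.[ℂ] E) : Set ℂ :=
  {z | ¬ ∃ R : E →L[ℂ] E, (∀ ξ, ∃ h : R ξ ∈ T.domain, T ⟨R ξ, h⟩ - z • R ξ = ξ) ∧
    ∀ ξ : T.domain, R (T ξ - z • (ξ : E)) = ξ}

/-- `U` is a strongly continuous one-parameter unitary group. -/
structure IsUnitaryGroup [CompleteSpace E] (U : ℝ → E →L[ℂ] E) : Prop where
  mem_unitary : ∀ t, U t ∈ unitary (E →L[ℂ] E)
  zero : U 0 = 1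
  add : ∀ s t, U (s + t) = U s * U t
  continuous : ∀ ξ, Continuous fun t => U t ξ

/-- `U t = e^{itT}`: `U` is a strongly continuous one-parameter unitary group whose generator,
in the sense of Stone's theorem, is `T`. -/
structure IsExpOf [CompleteSpace E] (U : ℝ → E →L[ℂ] E) (T : E →ₗ.[ℂ] E) : Prop
    extends IsUnitaryGroup U where
  generator : ∀ ξ η, (ξ, η) ∈ T.graph ↔ HasDerivAt (fun t => U t ξ) (Complex.I • η) 0

/-- The operator `T` is a Hamiltonian for the time evolution `σ` in the representation `π`: it is
self-adjoint and `π(σ_t(a)) = e^{itT} π(a) e^{-itT}`. -/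
def IsHamiltonian [CompleteSpace E] {A : Type} (σ : ℝ → A → A) (π : A → E →L[ℂ] E)
    (T : E →ₗ.[ℂ] E) : Prop :=
  IsSelfAdjoint T ∧ ∃ U : ℝ → E →L[ℂ] E, IsExpOf U T ∧
    ∀ t a, π (σ t a) = U t * π a * U (-t)

/-- The representation `π` has positive energy, with Hamiltonian `T`: the operator `T` implements
the time evolution and is nonnegative. -/
def IsPositiveEnergy [CompleteSpace E] {A : Type} (σ : ℝ → A → A) (π : A → E →L[ℂ] E)
    (T : E →ₗ.[ℂ] E) : Prop :=
  IsHamiltonian σ π T ∧ ∀ ξ : T.domain, 0 ≤ (inner ℂ (ξ : E) (T ξ)).re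

/-- The bounded operator `T` is of trace class with trace `c`: in every orthonormal basis the
diagonal of `T` is (absolutely) summable, with sum `c`. -/
def HasTrace (T : E →L[ℂ] E) (c : ℂ) : Prop :=
  ∀ (ι : Type) (b : HilbertBasis ι ℂ E), HasSum (fun i => inner ℂ (b i) (T (b i))) c

/-- The KMS condition at inverse temperature `β` for a functional `ψ` and a time evolution `σ`:
for all `a, b` there is a bounded continuous function `F` on the strip `0 ≤ Im z ≤ β`, holomorphic
inside, with `F(t) = ψ(a σ_t(b))` and `F(t + iβ) = ψ(σ_t(b) a)`. -/
def IsKMS {A : Type} [Mul A] (σ : ℝ → A → A) (β : ℝ) (ψ : A → ℂ) : Prop :=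
  ∀ a b : A, ∃ F : ℂ → ℂ,
    ContinuousOn F {z | 0 ≤ z.im ∧ z.im ≤ β} ∧
    DifferentiableOn ℂ F {z | 0 < z.im ∧ z.im < β} ∧
    (∃ C : ℝ, ∀ z : ℂ, 0 ≤ z.im → z.im ≤ β → ‖F z‖ ≤ C) ∧
    (∀ t : ℝ, F t = ψ (a * σ t b)) ∧
    ∀ t : ℝ, F (t + Complex.I * β) = ψ (σ t b * a)

variable {ι : Type}

/-- The multiplication operator `ξ ↦ h ξ` on `ℓ²(ι)` with its maximal domain. -/
def mulOp (h : ι → ℂ) : EllTwo ι →ₗ.[ℂ] EllTwo ι where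
  domain :=
    { carrier := {ξ | Memℓp (fun i => h i * ξ i) 2}
      zero_mem' := by
        change Memℓp (fun i => h i * (0 : EllTwo ι) i) 2
        have : (fun i => h i * (0 : EllTwo ι) i) = 0 := by
          funext i
          simp
        rw [this]
        exact zero_memℓp
      add_mem' := fun {ξ η} hξ hη => by
        have : (fun i => h i * (ξ + η) i) = (fun i => h i * ξ i) + fun i => h i * η i := by
          funext i
          simp [mul_add]
        change Memℓp (fun i => h i * (ξ + η) i) 2
        rw [this]
        exact Memℓp.add hξ hη
      smul_mem' := fun c ξ hξ => by
        have : (fun i => h i * (c • ξ) i) = c • fun i => h i * ξ i := by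
          funext i
          simp [mul_left_comm]
        change Memℓp (fun i => h i * (c • ξ) i) 2
        rw [this]
        exact Memℓp.const_smul hξ c }
  toFun :=
    { toFun := fun ξ => ⟨fun i => h i * ξ.1 i, ξ.2⟩
      map_add' := fun ξ η => by
        ext i
        exact mul_add _ _ _
      map_smul' := fun c ξ => by
        ext i
        exact mul_left_comm _ _ _ }

open Classical in
/-- The bounded operator that equals `mulOp h`; it is `0` in the case that `mulOp h` is not a
bounded everywhere defined operator. -/
def boundedMulOp (h : ι → ℂ) : EllTwo ι →L[ℂ] EllTwo ι :=
  if H : ∃ T : EllTwo ι →L[ℂ] EllTwo ι, (T : EllTwo ι →ₗ[ℂ] EllTwo ι).toPMap ⊤ = mulOp h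
  then H.choose else 0

end Operators

/-! ### The system attached to a prime number -/

section Adeles

open NumberField IsDedekindDomain

variable (p : ℕ) [Fact p.Prime]

/-- The place of `ℚ` at `p`. -/
def place : HeightOneSpectrum ℤ :=
  Rat.HeightOneSpectrum.primesEquiv.symm ⟨p, Fact.out⟩

/-- The adeles of `ℚ` whose component at `p` vanishes. -/
def AdeleAt : Type := {a : AdeleRing ℤ ℚ // a.2 (place p) = 0}

instance : TopologicalSpace (AdeleAt p) :=
  inferInstanceAs (TopologicalSpace {a : AdeleRing ℤ ℚ // a.2 (place p) = 0})

/-- The multiplicative group of `ℚ` acts by multiplication. -/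
instance : MulAction ℚˣ (AdeleAt p) where
  smul k a := ⟨algebraMap ℚ (AdeleRing ℤ ℚ) k * a.1, by
    change (algebraMap ℚ (AdeleRing ℤ ℚ) k).2 (place p) * a.1.2 (place p) = 0
    rw [a.2, mul_zero]⟩
  one_smul a := Subtype.ext (by
    change algebraMap ℚ (AdeleRing ℤ ℚ) (1 : ℚˣ) * a.1 = a.1
    simp)
  mul_smul k l a := Subtype.ext (by
    change algebraMap ℚ (AdeleRing ℤ ℚ) (k * l : ℚˣ) * a.1 =
      algebraMap ℚ (AdeleRing ℤ ℚ) k * (algebraMap ℚ (AdeleRing ℤ ℚ) l * a.1)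
    simp [mul_assoc])

instance : ContinuousConstSMul ℚˣ (AdeleAt p) where
  continuous_const_smul _ :=
    Continuous.subtype_mk (continuous_const.mul continuous_subtype_val) _

variable {p} in
/-- The absolute value of the archimedean component. -/
def absInf (a : AdeleAt p) : ℝ := ‖a.1.1 Rat.infinitePlace‖

/-- The open set of the `a` with `|a_∞| < 1` and `|a_w| ≤ 1` at every finite place `w`; it is the
space of units of the groupoid. -/
def openBox : Set (AdeleAt p) :=
  {a | absInf a < 1 ∧ ∀ w : HeightOneSpectrum ℤ, Valued.v (a.1.2 w) ≤ 1}

/-- The set of the `a` with `|a_w| = 1` at every finite place `w ≠ p` and `p⁻¹ ≤ |a_∞| < 1`. -/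
def unitBox : Set (AdeleAt p) :=
  {a | (∀ w : HeightOneSpectrum ℤ, w ≠ place p → Valued.v (a.1.2 w) = 1) ∧
    (p : ℝ)⁻¹ ≤ absInf a ∧ absInf a < 1}

/-- The C⋆-algebra of the groupoid of the `(k, x)`, `k ∈ ℚˣ`, such that `x` and `k x` are in
`openBox p`. -/
abbrev Alg : Type := CStar ℚˣ (AdeleAt p) (openBox p)

variable {p} in
/-- The fiber of the groupoid over `y`. -/
abbrev Orbit (y : AdeleAt p) : Type := Fiber (openBox p) ℚˣ y

/-- The function `k ↦ log |k|_p`. -/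
def logAbs (k : ℚˣ) : ℝ := Real.log (padicNorm p (k : ℚ) : ℝ)

theorem logAbs_mul (k l : ℚˣ) : logAbs p (k * l) = logAbs p k + logAbs p l := by
  unfold logAbs
  rw [Units.val_mul, padicNorm.mul, Rat.cast_mul, Real.log_mul]
  · exact_mod_cast padicNorm.nonzero k.ne_zero
  · exact_mod_cast padicNorm.nonzero l.ne_zero

/-- The character `k ↦ |k|_p^{it}`. -/
def timeChar (t : ℝ) : ℚˣ →* Circle where
  toFun k := Circle.exp (t * logAbs p k)
  map_one' := by simp [logAbs]
  map_mul' k l := by rw [logAbs_mul, mul_add, Circle.exp_add]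

/-- The time evolution `σ_t(f)(k, x) = |k|_p^{it} f(k, x)`. -/
def evolution (t : ℝ) : Alg p →⋆ₙₐ[ℂ] Alg p := CStar.twist (timeChar p t)

variable {p}

/-- The representation `π_y`. -/
def rep (y : AdeleAt p) : Alg p →⋆ₙₐ[ℂ] (EllTwo (Orbit y) →L[ℂ] EllTwo (Orbit y)) := regRep y

/-- The Hamiltonian `(H_y ξ)(k, y) = log |k|_p ξ(k, y)`. -/
def hamiltonian (y : AdeleAt p) : EllTwo (Orbit y) →ₗ.[ℂ] EllTwo (Orbit y) :=
  mulOp fun k => (logAbs p k.1 : ℂ)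

/-- The bounded operator `e^{-βH_y}`. -/
def expNegHamiltonian (β : ℝ) (y : AdeleAt p) : EllTwo (Orbit y) →L[ℂ] EllTwo (Orbit y) :=
  boundedMulOp fun k => (Real.exp (-β * logAbs p k.1) : ℂ)

end Adeles

/-! ### Digits -/

/-- The digits `c_k`, `k ≥ 0`, of the expansion `lam = ∑ c_k p^{-k}` of `lam ∈ (1, p]` in base
`p`; if there are two expansions, the one that does not terminate is meant. -/
def digit (p : ℕ) (lam : ℝ) (k : ℕ) : ℤ :=
  ⌈lam * (p : ℝ) ^ (k : ℤ) - 1⌉ - p * ⌈lam * (p : ℝ) ^ ((k : ℤ) - 1) - 1⌉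

/-- The function `f_p(lam, β) = ∑ c_k p^{-kβ}`. -/
def digitSum (p : ℕ) (lam β : ℝ) : ℝ := ∑' k : ℕ, (digit p lam k : ℝ) * (p : ℝ) ^ (-(k * β))

/-- The function `2 (1 - p^{-β}) / (1 - p^{1-β}) f_p(lam, β)`. -/
def partitionFunction (p : ℕ) (lam β : ℝ) : ℝ :=
  2 * ((1 - (p : ℝ) ^ (-β)) / (1 - (p : ℝ) ^ (1 - β))) * digitSum p lam β

theorem digit_mem (p : ℕ) (hp : 2 ≤ p) (lam : ℝ) (k : ℕ) :
    0 ≤ digit p lam k ∧ digit p lam k ≤ p - 1 := by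
  have hp0 : (0 : ℝ) < p := by positivity
  have e : lam * (p : ℝ) ^ (k : ℤ) = p * (lam * (p : ℝ) ^ ((k : ℤ) - 1)) := by
    rw [zpow_sub_one₀ hp0.ne']
    field_simp
  unfold digit
  rw [e]
  set x := lam * (p : ℝ) ^ ((k : ℤ) - 1)
  have h1 := Int.le_ceil (x - 1)
  have h2 := Int.ceil_lt_add_one (x - 1)
  set n := ⌈x - 1⌉
  have a1 : (p : ℤ) * n - 1 < ⌈(p : ℝ) * x - 1⌉ := by
    rw [Int.lt_ceil]
    push_cast
    nlinarith
  have a2 : ⌈(p : ℝ) * x - 1⌉ ≤ (p : ℤ) * n + p - 1 := by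
    rw [Int.ceil_le]
    push_cast
    nlinarith
  constructor <;> linarith

theorem sum_digit (p : ℕ) (hp : 2 ≤ p) (lam : ℝ) (h1 : 1 < lam) (h2 : lam ≤ p) (n : ℕ) :
    ∑ k ∈ Finset.range (n + 1), (digit p lam k : ℝ) * (p : ℝ) ^ (-(k : ℤ)) =
      ⌈lam * (p : ℝ) ^ (n : ℤ) - 1⌉ * (p : ℝ) ^ (-(n : ℤ)) := by
  have hp0 : (0 : ℝ) < p := by positivity
  induction n with
  | zero =>
    have : ⌈lam * (p : ℝ) ^ ((0 : ℤ) - 1) - 1⌉ = 0 := by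
      rw [Int.ceil_eq_iff]
      have : 0 < lam / p := by positivity
      have : lam / p ≤ 1 := (div_le_one hp0).mpr h2
      simp only [zero_sub, zpow_neg_one, ← div_eq_mul_inv]
      push_cast
      constructor <;> linarith
    simp only [zero_add, Finset.sum_range_one, digit, CharP.cast_eq_zero, this]
    simp
  | succ n ih =>
    rw [Finset.sum_range_succ, ih, digit]
    have : ((n + 1 : ℕ) : ℤ) - 1 = n := by push_cast; ring
    rw [this]
    have e : (p : ℝ) ^ (-(n : ℤ)) = p * (p : ℝ) ^ (-((n + 1 : ℕ) : ℤ)) := by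
      rw [← zpow_one_add₀ hp0.ne']
      congr 1
      push_cast
      ring
    rw [e]
    push_cast
    ring

theorem hasSum_digit (p : ℕ) (hp : 2 ≤ p) (lam : ℝ) (h1 : 1 < lam) (h2 : lam ≤ p) :
    HasSum (fun k : ℕ => (digit p lam k : ℝ) * (p : ℝ) ^ (-(k : ℤ))) lam := by
  have hp0 : (0 : ℝ) < p := by positivity
  rw [hasSum_iff_tendsto_nat_of_nonneg]
  · rw [← Filter.tendsto_add_atTop_iff_nat 1]
    simp only [sum_digit p hp lam h1 h2]
    have hz : Filter.Tendsto (fun n : ℕ => lam - (p : ℝ) ^ (-(n : ℤ))) Filter.atTop (nhds lam) := by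
      have : Filter.Tendsto (fun n : ℕ => ((p : ℝ)⁻¹) ^ n) Filter.atTop (nhds 0) :=
        tendsto_pow_atTop_nhds_zero_of_lt_one (by positivity)
          (inv_lt_one_of_one_lt₀ (by exact_mod_cast hp))
      simpa using this.const_sub lam
    refine tendsto_of_tendsto_of_tendsto_of_le_of_le hz tendsto_const_nhds (fun n => ?_)
      fun n => ?_
    · have h3 := Int.le_ceil (lam * (p : ℝ) ^ (n : ℤ) - 1)
      have h4 : (0 : ℝ) < (p : ℝ) ^ (-(n : ℤ)) := by positivity
      have h5 : (p : ℝ) ^ (n : ℤ) * (p : ℝ) ^ (-(n : ℤ)) = 1 := by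
        rw [← zpow_add₀ hp0.ne']; simp
      change lam - _ ≤ _
      nlinarith
    · have h3 := Int.ceil_lt_add_one (lam * (p : ℝ) ^ (n : ℤ) - 1)
      have h4 : (0 : ℝ) < (p : ℝ) ^ (-(n : ℤ)) := by positivity
      have h5 : (p : ℝ) ^ (n : ℤ) * (p : ℝ) ^ (-(n : ℤ)) = 1 := by
        rw [← zpow_add₀ hp0.ne']; simp
      change _ ≤ lam
      nlinarith
  · intro k
    have := (digit_mem p hp lam k).1
    have : (0 : ℝ) ≤ digit p lam k := by exact_mod_cast this
    positivity

theorem exists_digit_ne_zero (p : ℕ) (hp : 2 ≤ p) (lam : ℝ) (h1 : 1 < lam) (h2 : lam ≤ p)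
    (n : ℕ) : ∃ k, n < k ∧ digit p lam k ≠ 0 := by
  have hp0 : (0 : ℝ) < p := by positivity
  by_contra! h
  have h3 := (hasSum_sum_of_ne_finset_zero (s := Finset.range (n + 1))
    (f := fun k : ℕ => (digit p lam k : ℝ) * (p : ℝ) ^ (-(k : ℤ))) fun k hk => by
      rw [h k (by simpa using hk)]; simp).unique (hasSum_digit p hp lam h1 h2)
  rw [sum_digit p hp lam h1 h2] at h3
  have h4 := Int.ceil_lt_add_one (lam * (p : ℝ) ^ (n : ℤ) - 1)
  have h5 : (0 : ℝ) < (p : ℝ) ^ (-(n : ℤ)) := by positivity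
  have h6 : (p : ℝ) ^ (n : ℤ) * (p : ℝ) ^ (-(n : ℤ)) = 1 := by
    rw [← zpow_add₀ hp0.ne']; simp
  nlinarith

end ValuationSystem
end

/-!
The Hamiltonian `H_y` is diagonal in the standard basis of the Hilbert space of the orbit of `y`.
For `y` in `unitBox p` and `λ = |y_∞|⁻¹` the orbit consists of the nonzero `k ∈ ℤ[1/p]` with
`|k| < λ`, and `|k|_p` is its denominator, because a nonzero integer of absolute value less than
`p` is prime to `p`. This gives the positivity and the spectrum. There are `2 ⌈λ p^j - 1⌉` such `k`
with denominator dividing `p^j`; since `⌈λ p^j - 1⌉ / p^j` is the `j`-th partial sum of the digit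
expansion of `λ`, summation by parts and a Cauchy product with a geometric series evaluate the
partition function.

For a summable weight `w` the trace of `diag(w) A` is the weighted sum of the diagonal coefficients
of `A`. With `w = e^{-βh}` the KMS functions are the double series
`∑ e^{-βh_k} e^{iz(h_l - h_k)} A_{kl} B_{lk}`, which converge absolutely on the strip. The norm
`∑ w` is approached along functions in `C_c` of the unit space. For `f ∈ C_c` the functional is
`∑ w_k f(1, ky)`, a series dominated uniformly in `y`; a uniform bound on the norms extends the
continuity in `y` to the whole algebra.
-/

noncomputable section

open scoped ComplexConjugate
open Filter Topology

namespace ValuationSystem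

/-! ### Multiplication operators on `ℓ²` -/

section MulOp

variable {ι : Type}

theorem hasSum_norm_sq (ξ : EllTwo ι) : HasSum (fun i => ‖ξ i‖ ^ 2) (‖ξ‖ ^ 2) := by
  simpa using lp.hasSum_norm (p := 2) (by simp) ξ

theorem memℓp_two_of_le (ξ : EllTwo ι) {u : ι → ℂ} (C : ℝ) (h : ∀ i, ‖u i‖ ≤ C * ‖ξ i‖) :
    Memℓp u 2 := by
  refine memℓp_gen ?_
  have hs : Summable fun i => C ^ 2 * ‖ξ i‖ ^ 2 := (hasSum_norm_sq ξ).summable.mul_left _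
  simp only [ENNReal.toReal_ofNat, Real.rpow_ofNat]
  refine hs.of_nonneg_of_le (fun _ => by positivity) fun i => ?_
  rw [← mul_pow]
  exact pow_le_pow_left₀ (norm_nonneg _) (h i) 2

theorem ellTwo_norm_le_of_le (η ξ : EllTwo ι) {C : ℝ} (hC : 0 ≤ C)
    (h : ∀ i, ‖η i‖ ≤ C * ‖ξ i‖) : ‖η‖ ≤ C * ‖ξ‖ := by
  have hnorm : ‖(C : ℂ) • ξ‖ = C * ‖ξ‖ := by
    rw [norm_smul, Complex.norm_real, Real.norm_of_nonneg hC]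
  rw [← hnorm]
  refine lp.norm_mono (by simp) fun i => ?_
  rw [lp.coeFn_smul, Pi.smul_apply, norm_smul, Complex.norm_real, Real.norm_of_nonneg hC]
  exact h i

theorem tendsto_ellTwo_of_dominated {α : Type*} {l : Filter α} {F : α → EllTwo ι} {f : EllTwo ι}
    (g : EllTwo ι) (hF : ∀ i, Tendsto (fun a => F a i) l (𝓝 (f i)))
    (hb : ∀ a i, ‖F a i - f i‖ ≤ ‖g i‖) : Tendsto F l (𝓝 f) := by
  rw [tendsto_iff_norm_sub_tendsto_zero]
  have hsq : Tendsto (fun a => ∑' i, ‖F a i - f i‖ ^ 2) l (𝓝 (∑' _ : ι, (0 : ℝ))) := by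
    refine tendsto_tsum_of_dominated_convergence (hasSum_norm_sq g).summable (fun i => ?_)
      (Eventually.of_forall fun a i => ?_)
    · simpa using ((hF i).sub_const (f i)).norm.pow 2
    · rw [Real.norm_of_nonneg (by positivity)]
      exact pow_le_pow_left₀ (norm_nonneg _) (hb a i) 2
  have htsum : ∀ a, ∑' i, ‖F a i - f i‖ ^ 2 = ‖F a - f‖ ^ 2 := fun a =>
    (hasSum_norm_sq (F a - f)).tsum_eq
  simp only [htsum, tsum_zero] at hsq
  simpa [Real.sqrt_sq] using hsq.sqrt

/-- The bounded operator of multiplication by a bounded function. -/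
def mulCLM (h : ι → ℂ) {C : ℝ} (hC : ∀ i, ‖h i‖ ≤ C) : EllTwo ι →L[ℂ] EllTwo ι :=
  LinearMap.mkContinuous
    { toFun := fun ξ => ⟨fun i => h i * ξ i, memℓp_two_of_le ξ C fun i => by
        rw [norm_mul]; exact mul_le_mul_of_nonneg_right (hC i) (norm_nonneg _)⟩
      map_add' := fun ξ η => by
        ext i
        exact mul_add _ _ _
      map_smul' := fun c ξ => by
        ext i
        exact mul_left_comm _ _ _ } |C| fun ξ => by
      refine ellTwo_norm_le_of_le _ _ (abs_nonneg C) fun i => ?_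
      change ‖h i * ξ i‖ ≤ _
      rw [norm_mul]
      exact mul_le_mul_of_nonneg_right ((hC i).trans (le_abs_self C)) (norm_nonneg _)

@[simp] theorem mulCLM_apply (h : ι → ℂ) {C : ℝ} (hC : ∀ i, ‖h i‖ ≤ C) (ξ : EllTwo ι) (i : ι) :
    mulCLM h hC ξ i = h i * ξ i := rfl

theorem mem_domain_mulOp {h : ι → ℂ} {ξ : EllTwo ι} :
    ξ ∈ (mulOp h).domain ↔ Memℓp (fun i => h i * ξ i) 2 := Iff.rfl

theorem mulOp_apply {h : ι → ℂ} (ξ : (mulOp h).domain) (i : ι) :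
    mulOp h ξ i = h i * ξ.1 i := rfl

theorem mem_graph_mulOp {h : ι → ℂ} {ξ η : EllTwo ι} :
    (ξ, η) ∈ (mulOp h).graph ↔ ∀ i, η i = h i * ξ i := by
  rw [LinearPMap.mem_graph_iff]
  constructor
  · rintro ⟨x, rfl, rfl⟩ i
    rfl
  · intro hη
    have hξ : ξ ∈ (mulOp h).domain := by
      rw [mem_domain_mulOp, ← funext hη]
      exact lp.memℓp η
    exact ⟨⟨ξ, hξ⟩, rfl, by ext i; exact (hη i).symm⟩

theorem toPMap_top_eq_mulOp_iff {h : ι → ℂ} {T : EllTwo ι →L[ℂ] EllTwo ι} :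
    (T : EllTwo ι →ₗ[ℂ] EllTwo ι).toPMap ⊤ = mulOp h ↔ ∀ ξ i, T ξ i = h i * ξ i := by
  constructor
  · intro hT ξ
    have hgraph : (ξ, T ξ) ∈ (mulOp h).graph := by
      rw [← hT, LinearPMap.mem_graph_iff]
      exact ⟨⟨ξ, trivial⟩, rfl, rfl⟩
    exact mem_graph_mulOp.1 hgraph
  · intro hT
    apply LinearPMap.eq_of_eq_graph
    ext ⟨ξ, η⟩
    rw [mem_graph_mulOp, LinearPMap.mem_graph_iff]
    constructor
    · rintro ⟨x, rfl, rfl⟩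
      exact hT x
    · intro hη
      exact ⟨⟨ξ, trivial⟩, rfl, by ext i; exact (hT ξ i).trans (hη i).symm⟩

theorem boundedMulOp_eq (h : ι → ℂ) {C : ℝ} (hC : ∀ i, ‖h i‖ ≤ C) :
    boundedMulOp h = mulCLM h hC := by
  have hex : ∃ T : EllTwo ι →L[ℂ] EllTwo ι,
      (T : EllTwo ι →ₗ[ℂ] EllTwo ι).toPMap ⊤ = mulOp h :=
    ⟨mulCLM h hC, toPMap_top_eq_mulOp_iff.2 (mulCLM_apply h hC)⟩
  rw [boundedMulOp, dif_pos hex]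
  ext ξ i
  exact toPMap_top_eq_mulOp_iff.1 hex.choose_spec ξ i

/-- The standard orthonormal basis of `ℓ²`. -/
def stdBasis : HilbertBasis ι ℂ (EllTwo ι) := HilbertBasis.ofRepr (LinearIsometryEquiv.refl ℂ _)

theorem stdBasis_eq_single [DecidableEq ι] (k : ι) : stdBasis k = lp.single 2 k (1 : ℂ) :=
  (stdBasis.repr_symm_single k).symm

@[simp] theorem stdBasis_self (k : ι) : stdBasis k k = 1 := by
  classical
  rw [stdBasis_eq_single]
  exact Pi.single_eq_same (M := fun _ : ι => ℂ) k 1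

theorem stdBasis_of_ne {k l : ι} (h : l ≠ k) : stdBasis k l = 0 := by
  classical
  rw [stdBasis_eq_single]
  exact Pi.single_eq_of_ne (M := fun _ : ι => ℂ) h 1

@[simp] theorem norm_stdBasis (k : ι) : ‖stdBasis k‖ = 1 := stdBasis.orthonormal.1 k

@[simp] theorem inner_stdBasis_left (k : ι) (ξ : EllTwo ι) : inner ℂ (stdBasis k) ξ = ξ k :=
  (stdBasis.repr_apply_apply ξ k).symm

theorem mul_stdBasis (h : ι → ℂ) (k i : ι) : h i * stdBasis k i = h k * stdBasis k i := by
  by_cases hi : i = k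
  · rw [hi]
  · simp [stdBasis_of_ne hi]

theorem stdBasis_mem_graph (h : ι → ℂ) (k : ι) :
    (stdBasis k, h k • stdBasis k) ∈ (mulOp h).graph :=
  mem_graph_mulOp.2 fun i => (mul_stdBasis h k i).symm

theorem stdBasis_mem_domain (h : ι → ℂ) (k : ι) : stdBasis k ∈ (mulOp h).domain :=
  LinearPMap.mem_domain_of_mem_graph (stdBasis_mem_graph h k)

theorem mulOp_stdBasis (h : ι → ℂ) (k : ι) :
    mulOp h ⟨stdBasis k, stdBasis_mem_domain h k⟩ = h k • stdBasis k := by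
  ext i
  exact mul_stdBasis h k i

theorem dense_domain_mulOp (h : ι → ℂ) : Dense ((mulOp h).domain : Set (EllTwo ι)) := by
  refine (Submodule.dense_iff_topologicalClosure_eq_top.2 stdBasis.dense_span).mono ?_
  rw [SetLike.coe_subset_coe, Submodule.span_le]
  rintro _ ⟨k, rfl⟩
  exact stdBasis_mem_domain h k

theorem isSelfAdjoint_mulOp (h : ι → ℝ) : IsSelfAdjoint (mulOp fun i => (h i : ℂ)) := by
  rw [LinearPMap.isSelfAdjoint_def]
  apply LinearPMap.eq_of_eq_graph
  rw [LinearPMap.adjoint_graph_eq_graph_adjoint (dense_domain_mulOp _)]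
  ext ⟨ξ, η⟩
  rw [Submodule.mem_adjoint_iff, mem_graph_mulOp]
  constructor
  · intro hadj i
    have hi := hadj _ _ (stdBasis_mem_graph (fun i => (h i : ℂ)) i)
    simp only [inner_smul_left, inner_stdBasis_left, Complex.conj_ofReal] at hi
    linear_combination -hi
  · intro hη a b hab
    rw [mem_graph_mulOp] at hab
    rw [sub_eq_zero]
    refine (lp.hasSum_inner b ξ).unique ((lp.hasSum_inner a η).congr_fun fun i => ?_)
    simp only [hab i, hη i, RCLike.inner_apply, map_mul, Complex.conj_ofReal]
    ring

theorem mulOp_nonneg {h : ι → ℝ} (h0 : ∀ i, 0 ≤ h i) (ξ : (mulOp fun i => (h i : ℂ)).domain) :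
    0 ≤ (inner ℂ (ξ : EllTwo ι) (mulOp (fun i => (h i : ℂ)) ξ)).re := by
  have hsum := Complex.hasSum_re (lp.hasSum_inner (ξ : EllTwo ι) (mulOp (fun i => (h i : ℂ)) ξ))
  refine hsum.nonneg fun i => ?_
  have hterm : inner ℂ (ξ.1 i) (mulOp (fun i => (h i : ℂ)) ξ i) =
      ((h i * ‖ξ.1 i‖ ^ 2 : ℝ) : ℂ) := by
    rw [mulOp_apply, RCLike.inner_apply, mul_assoc, Complex.mul_conj, Complex.normSq_eq_norm_sq]
    push_cast
    ring
  rw [hterm, Complex.ofReal_re]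
  exact mul_nonneg (h0 i) (sq_nonneg _)

theorem notMem_unboundedSpectrum_mulOp {h : ι → ℂ} {z : ℂ} {ε : ℝ} (hε : 0 < ε)
    (hz : ∀ i, ε ≤ ‖h i - z‖) : z ∉ unboundedSpectrum (mulOp h) := by
  have hne : ∀ i, h i - z ≠ 0 := fun i => norm_pos_iff.1 (hε.trans_le (hz i))
  have hC : ∀ i, ‖(h i - z)⁻¹‖ ≤ ε⁻¹ := fun i => by
    rw [norm_inv]
    exact inv_anti₀ hε (hz i)
  have hgraph : ∀ ξ, (mulCLM _ hC ξ, ξ + z • mulCLM _ hC ξ) ∈ (mulOp h).graph := fun ξ => by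
    refine mem_graph_mulOp.2 fun i => ?_
    have := hne i
    simp only [lp.coeFn_add, lp.coeFn_smul, Pi.add_apply, Pi.smul_apply, mulCLM_apply,
      smul_eq_mul]
    field_simp
    ring
  refine not_not.2 ⟨mulCLM _ hC, fun ξ => ⟨LinearPMap.mem_domain_of_mem_graph (hgraph ξ), ?_⟩,
    fun ξ => ?_⟩
  · rw [← (LinearPMap.image_iff _).2 (hgraph ξ), add_sub_cancel_right]
  · ext i
    have := hne i
    simp only [lp.coeFn_sub, lp.coeFn_smul, Pi.sub_apply, Pi.smul_apply, mulCLM_apply,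
      smul_eq_mul, mulOp_apply]
    field_simp

theorem mem_unboundedSpectrum_mulOp {h : ι → ℂ} {z : ℂ} (hz : z ∈ closure (Set.range h)) :
    z ∈ unboundedSpectrum (mulOp h) := by
  rintro ⟨R, -, hR⟩
  have hle : ∀ k, 1 ≤ ‖R‖ * dist z (h k) := fun k => by
    have hk := hR ⟨stdBasis k, stdBasis_mem_domain h k⟩
    rw [mulOp_stdBasis, ← sub_smul] at hk
    have := R.le_opNorm ((h k - z) • stdBasis k)
    rwa [hk, norm_smul, norm_stdBasis, mul_one, ← dist_eq_norm, dist_comm] at this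
  obtain ⟨k, hk⟩ := Metric.mem_closure_range_iff.1 hz (‖R‖ + 1)⁻¹ (by positivity)
  have hlt : (‖R‖ + 1) * dist z (h k) < 1 := by rwa [← lt_inv_mul_iff₀ (by positivity), mul_one]
  linarith [hle k, dist_nonneg (x := z) (y := h k)]

theorem unboundedSpectrum_mulOp (h : ι → ℂ) :
    unboundedSpectrum (mulOp h) = closure (Set.range h) := by
  refine subset_antisymm (fun z hz => ?_) fun z => mem_unboundedSpectrum_mulOp
  contrapose! hz
  obtain ⟨ε, hε, hdist⟩ : ∃ ε > 0, ∀ k, ε ≤ dist z (h k) := by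
    simpa only [Metric.mem_closure_range_iff, not_forall, not_exists, not_lt, exists_prop] using hz
  exact notMem_unboundedSpectrum_mulOp hε fun k => by
    rw [← dist_eq_norm, dist_comm]
    exact hdist k

end MulOp

/-! ### Diagonal unitaries and their generators -/

section DiagonalUnitary

variable {ι : Type}

/-- The unitary operator of multiplication by a function with values in the circle. -/
def circleMul : (ι → Circle) →* (EllTwo ι →L[ℂ] EllTwo ι) where
  toFun u := mulCLM (fun i => (u i : ℂ)) (C := 1) fun i => (Circle.norm_coe (u i)).le
  map_one' := by
    ext ξ i
    simp
  map_mul' u v := by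
    ext ξ i
    simp [mul_assoc]

@[simp] theorem circleMul_apply (u : ι → Circle) (ξ : EllTwo ι) (i : ι) :
    circleMul u ξ i = u i * ξ i := rfl

theorem circleMul_stdBasis (u : ι → Circle) (k : ι) :
    circleMul u (stdBasis k) = (u k : ℂ) • stdBasis k := by
  ext i
  exact mul_stdBasis (fun i => (u i : ℂ)) k i

theorem star_circleMul (u : ι → Circle) : star (circleMul u) = circleMul u⁻¹ := by
  symm
  rw [ContinuousLinearMap.star_eq_adjoint, ContinuousLinearMap.eq_adjoint_iff]
  intro η ξ
  refine (lp.hasSum_inner _ _).unique ((lp.hasSum_inner _ _).congr_fun fun i => ?_)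
  simp only [circleMul_apply, Pi.inv_apply, Circle.coe_inv_eq_conj, RCLike.inner_apply, map_mul,
    Complex.conj_conj]
  ring

theorem circleMul_mem_unitary (u : ι → Circle) :
    circleMul u ∈ unitary (EllTwo ι →L[ℂ] EllTwo ι) := by
  rw [Unitary.mem_iff, star_circleMul, ← map_mul, ← map_mul, inv_mul_cancel, mul_inv_cancel,
    map_one]
  exact ⟨rfl, rfl⟩

/-- The unitary operator of multiplication by `e^{ith}`. -/
def expMul (h : ι → ℝ) (t : ℝ) : EllTwo ι →L[ℂ] EllTwo ι :=
  circleMul fun i => Circle.exp (t * h i)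

theorem expMul_apply (h : ι → ℝ) (t : ℝ) (ξ : EllTwo ι) (i : ι) :
    expMul h t ξ i = Circle.exp (t * h i) * ξ i := rfl

theorem expMul_zero (h : ι → ℝ) : expMul h 0 = 1 := by
  ext ξ i
  simp [expMul_apply]

theorem expMul_add (h : ι → ℝ) (s t : ℝ) : expMul h (s + t) = expMul h s * expMul h t := by
  ext ξ i
  simp [expMul_apply, add_mul, Circle.exp_add, mul_assoc]

theorem continuous_expMul (h : ι → ℝ) (ξ : EllTwo ι) : Continuous fun t => expMul h t ξ := by
  refine continuous_iff_continuousAt.2 fun s =>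
    tendsto_ellTwo_of_dominated ((2 : ℂ) • ξ) (fun i => ?_) fun t i => ?_
  · have hi : Continuous fun t : ℝ => (Circle.exp (t * h i) : ℂ) * ξ i := by fun_prop
    exact hi.tendsto s
  · refine (norm_sub_le _ _).trans_eq ?_
    simp only [expMul_apply, norm_mul, Circle.norm_coe, lp.coeFn_smul, Pi.smul_apply, norm_smul,
      Complex.norm_ofNat]
    ring

theorem hasDerivAt_circleExp_mul (c : ℝ) :
    HasDerivAt (fun t : ℝ => (Circle.exp (t * c) : ℂ)) (Complex.I * c) 0 := by
  have hlin : HasDerivAt (fun t : ℝ => ((t * c : ℝ) : ℂ) * Complex.I) (c * Complex.I) 0 := by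
    simpa using (((hasDerivAt_id (0 : ℝ)).mul_const c).ofReal_comp).mul_const Complex.I
  simpa [mul_comm] using hlin.cexp

theorem norm_circleExp_mul_sub_one_le (t c : ℝ) : ‖(Circle.exp (t * c) : ℂ) - 1‖ ≤ |t| * |c| := by
  rw [Circle.coe_exp, mul_comm _ Complex.I, ← abs_mul]
  exact Real.norm_exp_I_mul_ofReal_sub_one_le

theorem hasDerivAt_expMul {h : ι → ℝ} {ξ η : EllTwo ι} (hη : ∀ i, η i = h i * ξ i) :
    HasDerivAt (fun t => expMul h t ξ) (Complex.I • η) 0 := by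
  refine hasDerivAt_iff_tendsto_slope_zero.2 ?_
  refine tendsto_ellTwo_of_dominated ((2 : ℂ) • η) (fun i => ?_) fun t i => ?_
  · have hi := ((hasDerivAt_circleExp_mul (h i)).mul_const (ξ i)).tendsto_slope_zero
    rw [mul_assoc, ← hη i] at hi
    exact hi
  · have hquot : ‖t⁻¹ • (Circle.exp (t * h i) * ξ i - ξ i)‖ ≤ ‖η i‖ := by
      rcases eq_or_ne t 0 with rfl | ht
      · simp
      rw [norm_smul, norm_inv, Real.norm_eq_abs, inv_mul_le_iff₀ (abs_pos.2 ht), ← sub_one_mul,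
        norm_mul, hη, norm_mul, Complex.norm_real, Real.norm_eq_abs, ← mul_assoc]
      exact mul_le_mul_of_nonneg_right (norm_circleExp_mul_sub_one_le t (h i)) (norm_nonneg _)
    calc _ = ‖t⁻¹ • (Circle.exp (t * h i) * ξ i - ξ i) - Complex.I * η i‖ := by
            rw [zero_add, expMul_zero]
            rfl
      _ ≤ ‖η i‖ + ‖η i‖ := by
            refine (norm_sub_le _ _).trans (add_le_add hquot ?_)
            rw [norm_mul, Complex.norm_I, one_mul]
      _ = ‖((2 : ℂ) • η) i‖ := by
            rw [lp.coeFn_smul, Pi.smul_apply, norm_smul, Complex.norm_ofNat, two_mul]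

theorem eq_mul_of_hasDerivAt_expMul {h : ι → ℝ} {ξ η : EllTwo ι}
    (H : HasDerivAt (fun t => expMul h t ξ) (Complex.I • η) 0) (i : ι) : η i = h i * ξ i := by
  have hcoord : HasDerivAt (fun t => inner ℂ (stdBasis i) (expMul h t ξ))
      (inner ℂ (stdBasis i) (Complex.I • η)) 0 :=
    ((innerSL ℂ (stdBasis i : EllTwo ι)).restrictScalars ℝ).hasFDerivAt.comp_hasDerivAt 0 H
  simp only [inner_stdBasis_left, expMul_apply] at hcoord
  simpa [mul_assoc] using hcoord.unique ((hasDerivAt_circleExp_mul (h i)).mul_const (ξ i))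

theorem isExpOf_expMul (h : ι → ℝ) : IsExpOf (expMul h) (mulOp fun i => (h i : ℂ)) where
  mem_unitary _ := circleMul_mem_unitary _
  zero := expMul_zero h
  add := expMul_add h
  continuous := continuous_expMul h
  generator _ _ := mem_graph_mulOp.trans ⟨hasDerivAt_expMul, eq_mul_of_hasDerivAt_expMul⟩

end DiagonalUnitary

/-! ### Traces of products with diagonal operators -/

section Trace

theorem hasSum_norm_inner_sq {κ E : Type} [NormedAddCommGroup E] [InnerProductSpace ℂ E]
    (b : HilbertBasis κ ℂ E) (x : E) : HasSum (fun i => ‖inner ℂ (b i) x‖ ^ 2) (‖x‖ ^ 2) := by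
  simpa only [b.repr_apply_apply, b.repr.norm_map] using hasSum_norm_sq (b.repr x)

theorem tsum_norm_inner_mul_inner_le {κ E : Type} [NormedAddCommGroup E] [InnerProductSpace ℂ E]
    (b : HilbertBasis κ ℂ E) (x y : E) :
    ∑' i, ‖inner ℂ x (b i) * inner ℂ (b i) y‖ ≤ ‖x‖ * ‖y‖ := by
  have hx : HasSum (fun i => ‖inner ℂ x (b i)‖ ^ (2 : ℝ)) (‖x‖ ^ (2 : ℝ)) := by
    simpa only [Real.rpow_two, norm_inner_symm x] using hasSum_norm_inner_sq b x
  have hy : HasSum (fun i => ‖inner ℂ (b i) y‖ ^ (2 : ℝ)) (‖y‖ ^ (2 : ℝ)) := by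
    simpa only [Real.rpow_two] using hasSum_norm_inner_sq b y
  obtain ⟨C, -, hC, hsum⟩ := Real.inner_le_Lp_mul_Lq_hasSum_of_nonneg .two_two (norm_nonneg x)
    (norm_nonneg y) (fun _ => norm_nonneg _) (fun _ => norm_nonneg _) hx hy
  simp only [norm_mul]
  exact hsum.tsum_eq.trans_le hC

theorem summable_mul_of_tsum_le {ι κ : Type*} {w : ι → ℝ} (hw : Summable w) {u : ι → κ → ℝ}
    (hu : ∀ k i, 0 ≤ u k i) (hsum : ∀ k, Summable (u k)) {C : ℝ} (hC : ∀ k, ∑' i, u k i ≤ C) :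
    Summable fun x : ι × κ => ‖w x.1‖ * u x.1 x.2 := by
  rw [summable_prod_of_nonneg fun x => mul_nonneg (norm_nonneg _) (hu x.1 x.2)]
  refine ⟨fun k => (hsum k).mul_left ‖w k‖, ?_⟩
  simp only [tsum_mul_left]
  exact Summable.of_nonneg_of_le (fun k => mul_nonneg (norm_nonneg _) (tsum_nonneg (hu k)))
    (fun k => mul_le_mul_of_nonneg_left (hC k) (norm_nonneg (w k))) (hw.norm.mul_right C)

theorem summable_mul_inner_mul_inner {ι κ E : Type} [NormedAddCommGroup E]
    [InnerProductSpace ℂ E] (b : HilbertBasis κ ℂ E) {w : ι → ℝ} (hw : Summable w) {f g : ι → E}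
    {C D : ℝ} (hf : ∀ k, ‖f k‖ ≤ C) (hg : ∀ k, ‖g k‖ ≤ D) :
    Summable fun x : ι × κ =>
      (w x.1 : ℂ) * (inner ℂ (f x.1) (b x.2) * inner ℂ (b x.2) (g x.1)) := by
  have hrow : ∀ k, ∑' i, ‖inner ℂ (f k) (b i) * inner ℂ (b i) (g k)‖ ≤ C * D := fun k =>
    (tsum_norm_inner_mul_inner_le b _ _).trans
      (mul_le_mul (hf k) (hg k) (norm_nonneg _) ((norm_nonneg _).trans (hf k)))
  refine Summable.of_norm_bounded (summable_mul_of_tsum_le hw (fun _ _ => norm_nonneg _)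
    (fun k => (b.summable_inner_mul_inner (f k) (g k)).norm) hrow) fun x => ?_
  rw [norm_mul, Complex.norm_real]

variable {ι : Type}

theorem norm_apply_stdBasis_le (A : EllTwo ι →L[ℂ] EllTwo ι) (k : ι) :
    ‖A (stdBasis k)‖ ≤ ‖A‖ := by
  simpa using A.le_opNorm (stdBasis k)

theorem norm_coeff_le (A : EllTwo ι →L[ℂ] EllTwo ι) (k l : ι) : ‖A (stdBasis l) k‖ ≤ ‖A‖ :=
  (lp.norm_apply_le_norm (by simp) _ k).trans (norm_apply_stdBasis_le A l)

theorem norm_star_apply_stdBasis_le (A : EllTwo ι →L[ℂ] EllTwo ι) (k : ι) :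
    ‖star A (stdBasis k)‖ ≤ ‖A‖ :=
  (norm_apply_stdBasis_le _ k).trans_eq (norm_star A)

theorem inner_star_apply_stdBasis (A : EllTwo ι →L[ℂ] EllTwo ι) (k : ι) (ξ : EllTwo ι) :
    inner ℂ (star A (stdBasis k)) ξ = A ξ k := by
  rw [ContinuousLinearMap.star_eq_adjoint, ContinuousLinearMap.adjoint_inner_left,
    inner_stdBasis_left]

theorem hasSum_coeff_mul_coeff (A B : EllTwo ι →L[ℂ] EllTwo ι) (k l : ι) :
    HasSum (fun m => A (stdBasis m) k * B (stdBasis l) m) ((A * B) (stdBasis l) k) := by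
  have hsum := stdBasis.hasSum_inner_mul_inner (star A (stdBasis k)) (B (stdBasis l))
  rw [inner_star_apply_stdBasis] at hsum
  exact hsum.congr_fun fun m => by rw [inner_star_apply_stdBasis, inner_stdBasis_left]

theorem summable_mul_coeff {w : ι → ℝ} (hw : Summable w) (A : EllTwo ι →L[ℂ] EllTwo ι) :
    Summable fun k => (w k : ℂ) * A (stdBasis k) k := by
  refine Summable.of_norm_bounded (hw.norm.mul_right ‖A‖) fun k => ?_
  rw [norm_mul, Complex.norm_real]
  exact mul_le_mul_of_nonneg_left (norm_coeff_le A k k) (norm_nonneg _)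

/-- The functional `A ↦ Tr(diag(w) A) = ∑ w_k A_kk` on the bounded operators on `ℓ²`, for
summable weights `w`. -/
def diagTrace {w : ι → ℝ} (hw : Summable w) : StrongDual ℂ (EllTwo ι →L[ℂ] EllTwo ι) :=
  LinearMap.mkContinuous
    { toFun := fun A => ∑' k, (w k : ℂ) * A (stdBasis k) k
      map_add' := fun A B => by
        rw [← (summable_mul_coeff hw A).tsum_add (summable_mul_coeff hw B)]
        exact tsum_congr fun k => mul_add _ _ _
      map_smul' := fun c A => by
        rw [RingHom.id_apply, smul_eq_mul, ← tsum_mul_left]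
        exact tsum_congr fun k => mul_left_comm _ _ _ }
    (∑' k, ‖w k‖) fun A => by
      refine tsum_of_norm_bounded (hw.norm.hasSum.mul_right ‖A‖) fun k => ?_
      rw [norm_mul, Complex.norm_real]
      exact mul_le_mul_of_nonneg_left (norm_coeff_le A k k) (norm_nonneg _)

theorem diagTrace_apply {w : ι → ℝ} (hw : Summable w) (A : EllTwo ι →L[ℂ] EllTwo ι) :
    diagTrace hw A = ∑' k, (w k : ℂ) * A (stdBasis k) k := rfl

theorem norm_diagTrace_le {w : ι → ℝ} (hw : Summable w) : ‖diagTrace hw‖ ≤ ∑' k, ‖w k‖ :=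
  LinearMap.mkContinuous_norm_le _ (tsum_nonneg fun _ => norm_nonneg _) _

theorem diagTrace_one {w : ι → ℝ} (hw : Summable w) : diagTrace hw 1 = ((∑' k, w k : ℝ) : ℂ) := by
  simp [diagTrace_apply, Complex.ofReal_tsum]

theorem diagTrace_star_mul_self {w : ι → ℝ} (hw : Summable w) (A : EllTwo ι →L[ℂ] EllTwo ι) :
    diagTrace hw (star A * A) = ((∑' k, w k * ‖A (stdBasis k)‖ ^ 2 : ℝ) : ℂ) := by
  rw [diagTrace_apply, Complex.ofReal_tsum]
  refine tsum_congr fun k => ?_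
  rw [mul_apply_eq_comp, ← inner_stdBasis_left, ContinuousLinearMap.star_eq_adjoint,
    ContinuousLinearMap.adjoint_inner_right, inner_self_eq_norm_sq_to_K]
  push_cast
  rfl

theorem hasTrace_boundedMulOp_mul {w : ι → ℝ} (hw : Summable w)
    (A : EllTwo ι →L[ℂ] EllTwo ι) :
    HasTrace (boundedMulOp (fun k => (w k : ℂ)) * A) (diagTrace hw A) := by
  have hbound : ∀ k, ‖(w k : ℂ)‖ ≤ ∑' k, ‖w k‖ := fun k => by
    rw [Complex.norm_real]
    exact hw.norm.le_tsum k fun _ _ => norm_nonneg _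
  rw [boundedMulOp_eq _ hbound]
  intro κ b
  let G : ι × κ → ℂ := fun x =>
    (w x.1 : ℂ) * (inner ℂ (star A (stdBasis x.1)) (b x.2) * inner ℂ (b x.2) (stdBasis x.1))
  have hG : Summable G :=
    summable_mul_inner_mul_inner b hw (f := fun k => star A (stdBasis k))
      (g := fun k => stdBasis k) (norm_star_apply_stdBasis_le A) fun k => (norm_stdBasis k).le
  have hrow : ∀ k, HasSum (fun i => G (k, i)) ((w k : ℂ) * A (stdBasis k) k) := fun k => by
    have hk := (b.hasSum_inner_mul_inner (star A (stdBasis k)) (stdBasis k)).mul_left (w k : ℂ)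
    rwa [inner_star_apply_stdBasis] at hk
  have hcol : ∀ i, HasSum (fun k => G (k, i))
      (inner ℂ (b i) ((mulCLM (fun k => (w k : ℂ)) hbound * A) (b i))) := fun i => by
    have hi := lp.hasSum_inner (𝕜 := ℂ) (b i) ((mulCLM (fun k => (w k : ℂ)) hbound * A) (b i))
    refine hi.congr_fun fun k => ?_
    simp only [G, inner_star_apply_stdBasis, mul_apply_eq_comp, mulCLM_apply, RCLike.inner_apply]
    rw [← inner_conj_symm (b i), inner_stdBasis_left]
    ring
  have hswap : HasSum (fun x : κ × ι => G (x.2, x.1)) (∑' x, G x) :=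
    (Equiv.prodComm κ ι).hasSum_iff.mpr hG.hasSum
  have hdiag := hswap.prod_fiberwise hcol
  rwa [diagTrace_apply, (hG.hasSum.prod_fiberwise hrow).tsum_eq]

end Trace

/-! ### The KMS condition -/

section KMS

theorem IsKMS.comp {A B F : Type} [Mul A] [Mul B] [FunLike F A B] [MulHomClass F A B]
    {σ : ℝ → A → A} {τ : ℝ → B → B} {β : ℝ} {ψ : B → ℂ} (hψ : IsKMS τ β ψ) (π : F)
    (hπ : ∀ t a, π (σ t a) = τ t (π a)) : IsKMS σ β fun a => ψ (π a) := by
  intro a b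
  simpa only [map_mul, hπ] using hψ (π a) (π b)

variable {ι : Type}

theorem conj_expMul_coeff (h : ι → ℝ) (t : ℝ) (B : EllTwo ι →L[ℂ] EllTwo ι) (k l : ι) :
    (expMul h t * B * expMul h (-t)) (stdBasis l) k =
      Complex.exp (Complex.I * t * h k - Complex.I * t * h l) * B (stdBasis l) k := by
  rw [mul_apply_eq_comp, mul_apply_eq_comp, expMul, expMul, circleMul_stdBasis, map_smul,
    circleMul_apply, lp.coeFn_smul, Pi.smul_apply, smul_eq_mul, ← mul_assoc, Circle.coe_exp,
    Circle.coe_exp, ← Complex.exp_add]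
  push_cast
  ring_nf

/-- The terms of the double series `∑ A_kl B_lk e^{-(β + iz) h_k + iz h_l}`, which interpolates
between the two sides of the KMS condition for the weights `e^{-βh}`. -/
def kmsTerm (h : ι → ℝ) (β : ℝ) (A B : EllTwo ι →L[ℂ] EllTwo ι) (z : ℂ) (x : ι × ι) : ℂ :=
  A (stdBasis x.2) x.1 * B (stdBasis x.1) x.2 *
    Complex.exp (-(β + Complex.I * z) * h x.1 + Complex.I * z * h x.2)

theorem kmsTerm_swap (h : ι → ℝ) (β : ℝ) (A B : EllTwo ι →L[ℂ] EllTwo ι) (z : ℂ) (x : ι × ι) :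
    kmsTerm h β A B (z + Complex.I * β) x.swap = kmsTerm h β B A (-z) x := by
  simp only [kmsTerm, Prod.fst_swap, Prod.snd_swap]
  rw [mul_comm (A _ _)]
  congr 2
  linear_combination (β * h x.1 - β * h x.2 : ℂ) * Complex.I_mul_I

theorem differentiable_kmsTerm (h : ι → ℝ) (β : ℝ) (A B : EllTwo ι →L[ℂ] EllTwo ι) (x : ι × ι) :
    Differentiable ℂ fun z => kmsTerm h β A B z x := by
  unfold kmsTerm
  fun_prop

theorem exp_neg_interpolate_le {β s : ℝ} (h0 : 0 ≤ s) (h1 : s ≤ β) (x y : ℝ) :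
    Real.exp (-(β - s) * x - s * y) ≤ Real.exp (-β * x) + Real.exp (-β * y) := by
  rcases le_total x y with h | h
  · refine le_add_of_le_of_nonneg (Real.exp_le_exp.2 ?_) (Real.exp_pos _).le
    nlinarith
  · refine le_add_of_nonneg_of_le (Real.exp_pos _).le (Real.exp_le_exp.2 ?_)
    nlinarith

theorem norm_kmsTerm_le (h : ι → ℝ) {β : ℝ} (A B : EllTwo ι →L[ℂ] EllTwo ι) {z : ℂ}
    (hz : z ∈ {z : ℂ | 0 ≤ z.im ∧ z.im ≤ β}) (x : ι × ι) :
    ‖kmsTerm h β A B z x‖ ≤ (Real.exp (-β * h x.1) + Real.exp (-β * h x.2)) *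
      ‖A (stdBasis x.2) x.1 * B (stdBasis x.1) x.2‖ := by
  have hre : (-(β + Complex.I * z) * h x.1 + Complex.I * z * h x.2).re =
      -(β - z.im) * h x.1 - z.im * h x.2 := by
    simp [Complex.add_re, Complex.mul_re]
    ring
  rw [kmsTerm, norm_mul, Complex.norm_exp, hre, mul_comm]
  exact mul_le_mul_of_nonneg_right (exp_neg_interpolate_le hz.1 hz.2 _ _) (norm_nonneg _)

theorem summable_mul_norm_coeff_mul_coeff {w : ι → ℝ} (hw : Summable w)
    (A B : EllTwo ι →L[ℂ] EllTwo ι) :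
    Summable fun x : ι × ι => ‖w x.1‖ * ‖A (stdBasis x.2) x.1 * B (stdBasis x.1) x.2‖ := by
  have hsum := (summable_mul_inner_mul_inner stdBasis hw (norm_star_apply_stdBasis_le A)
    (norm_apply_stdBasis_le B)).norm
  simpa only [inner_star_apply_stdBasis, inner_stdBasis_left, norm_mul _ (_ * _),
    Complex.norm_real] using hsum

theorem summable_kmsTerm_bound {h : ι → ℝ} {β : ℝ} (hw : Summable fun k => Real.exp (-β * h k))
    (A B : EllTwo ι →L[ℂ] EllTwo ι) :
    Summable fun x : ι × ι => (Real.exp (-β * h x.1) + Real.exp (-β * h x.2)) *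
      ‖A (stdBasis x.2) x.1 * B (stdBasis x.1) x.2‖ := by
  have hfst := summable_mul_norm_coeff_mul_coeff hw A B
  have hsnd := (Equiv.prodComm ι ι).summable_iff.mpr (summable_mul_norm_coeff_mul_coeff hw B A)
  refine (hfst.add hsnd).congr fun x => ?_
  simp only [Function.comp_apply, Equiv.prodComm_apply, Prod.fst_swap, Prod.snd_swap,
    Real.norm_of_nonneg (Real.exp_pos _).le]
  rw [mul_comm (B _ _), add_mul]

theorem tsum_kmsTerm_ofReal {h : ι → ℝ} {β : ℝ} (hβ : 0 ≤ β)
    (hw : Summable fun k => Real.exp (-β * h k)) (A B : EllTwo ι →L[ℂ] EllTwo ι) (t : ℝ) :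
    ∑' x, kmsTerm h β A B t x = diagTrace hw (A * (expMul h t * B * expMul h (-t))) := by
  have hsum : Summable (kmsTerm h β A B t) :=
    Summable.of_norm_bounded (summable_kmsTerm_bound hw A B) (norm_kmsTerm_le h A B (by simpa))
  refine ((hsum.hasSum.prod_fiberwise fun k => ?_).tsum_eq).symm
  refine ((hasSum_coeff_mul_coeff A _ k k).mul_left _).congr_fun fun l => ?_
  rw [conj_expMul_coeff, kmsTerm, Complex.ofReal_exp,
    show (-(β + Complex.I * t) * h k + Complex.I * t * h l : ℂ) =
      ((-β * h k : ℝ) : ℂ) + (Complex.I * t * h l - Complex.I * t * h k) by push_cast; ring,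
    Complex.exp_add]
  ring

theorem diagTrace_conj_expMul {w : ι → ℝ} (hw : Summable w) (h : ι → ℝ) (t : ℝ)
    (A : EllTwo ι →L[ℂ] EllTwo ι) :
    diagTrace hw (expMul h t * A * expMul h (-t)) = diagTrace hw A := by
  simp only [diagTrace_apply, conj_expMul_coeff, sub_self, Complex.exp_zero, one_mul]

theorem tsum_kmsTerm_add_I_mul {h : ι → ℝ} {β : ℝ} (hβ : 0 ≤ β)
    (hw : Summable fun k => Real.exp (-β * h k)) (A B : EllTwo ι →L[ℂ] EllTwo ι) (t : ℝ) :
    ∑' x, kmsTerm h β A B (t + Complex.I * β) x =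
      diagTrace hw (expMul h t * B * expMul h (-t) * A) := by
  have hcancel : expMul h (-t) * expMul h t = 1 := by
    rw [← expMul_add, neg_add_cancel, expMul_zero]
  calc ∑' x, kmsTerm h β A B (t + Complex.I * β) x
      = ∑' x : ι × ι, kmsTerm h β A B (t + Complex.I * β) x.swap :=
        ((Equiv.prodComm ι ι).tsum_eq _).symm
    _ = ∑' x, kmsTerm h β B A ((-t : ℝ) : ℂ) x := by simp only [kmsTerm_swap, Complex.ofReal_neg]
    _ = diagTrace hw (B * (expMul h (-t) * A * expMul h (- -t))) := tsum_kmsTerm_ofReal hβ hw B A _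
    _ = diagTrace hw (expMul h (-t) * (expMul h t * B * expMul h (-t) * A) * expMul h (- -t)) := by
        simp only [← mul_assoc, hcancel, one_mul]
    _ = diagTrace hw (expMul h t * B * expMul h (-t) * A) := diagTrace_conj_expMul hw h (-t) _

theorem isKMS_diagTrace {h : ι → ℝ} {β : ℝ} (hβ : 0 ≤ β)
    (hw : Summable fun k => Real.exp (-β * h k)) :
    IsKMS (fun t B => expMul h t * B * expMul h (-t)) β (diagTrace hw) := by
  intro A B
  have hbound := summable_kmsTerm_bound hw A B
  have hdiff := differentiable_kmsTerm h β A B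
  refine ⟨fun z => ∑' x, kmsTerm h β A B z x, ?_, ?_,
    ⟨∑' x : ι × ι, (Real.exp (-β * h x.1) + Real.exp (-β * h x.2)) *
      ‖A (stdBasis x.2) x.1 * B (stdBasis x.1) x.2‖, fun z h0 h1 => ?_⟩,
    tsum_kmsTerm_ofReal hβ hw A B, tsum_kmsTerm_add_I_mul hβ hw A B⟩
  · exact continuousOn_tsum (fun x => (hdiff x).continuous.continuousOn) hbound
      fun x z hz => norm_kmsTerm_le h A B hz x
  · refine Complex.differentiableOn_tsum_of_summable_norm hbound
      (fun x => (hdiff x).differentiableOn) ?_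
      fun x z hz => norm_kmsTerm_le h A B ⟨hz.1.le, hz.2.le⟩ x
    exact (isOpen_lt continuous_const Complex.continuous_im).inter
      (isOpen_lt Complex.continuous_im continuous_const)
  · exact tsum_of_norm_bounded hbound.hasSum fun x => norm_kmsTerm_le h A B ⟨h0, h1⟩ x

end KMS

/-! ### Weighted traces in the regular representations -/

section UnitSpace

variable {Γ X : Type} [Group Γ] [TopologicalSpace X] [MulAction Γ X] {U : Set X}

open Classical in
/-- A compactly supported continuous function on the unit space, as an element of the convolution
algebra: the unit space is the slice of the groupoid over `1`. -/
def Cc.ofUnits (g : X → ℂ) (hg : Continuous g) (hc : HasCompactSupport g) (hU : tsupport g ⊆ U) :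
    Cc Γ X U :=
  ⟨fun k => if k = 1 then g else 0, by
    refine ⟨(Set.finite_singleton 1).subset fun k hk => by_contra fun h => hk (if_neg h),
      fun k => ?_⟩
    beta_reduce
    split_ifs with hk
    · exact ⟨hg, hc, fun x hx => ⟨hU hx, by rw [hk, one_smul]; exact hU hx⟩⟩
    · exact ⟨continuous_const, HasCompactSupport.zero, by simp [tsupport]⟩⟩

theorem Cc.ofUnits_one {g : X → ℂ} (hg : Continuous g) (hc : HasCompactSupport g)
    (hU : tsupport g ⊆ U) : (ofUnits g hg hc hU : Cc Γ X U) 1 = g := if_pos rfl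

theorem Cc.ofUnits_of_ne {g : X → ℂ} (hg : Continuous g) (hc : HasCompactSupport g)
    (hU : tsupport g ⊆ U) {k : Γ} (hk : k ≠ 1) : (ofUnits g hg hc hU : Cc Γ X U) k = 0 :=
  if_neg hk

variable [ContinuousConstSMul Γ X]

theorem Cc.ellOne_ofUnits_le {g : X → ℂ} (hg : Continuous g) (hc : HasCompactSupport g)
    (hU : tsupport g ⊆ U) {C : ℝ} (hC : 0 ≤ C) (hgC : ∀ x, ‖g x‖ ≤ C) :
    (ofUnits g hg hc hU : Cc Γ X U).ellOne ≤ C := by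
  refine (Cc.ellOne_le (S := {1}) (C := fun _ => C) (fun k hk => ?_) (fun _ => hC)
    fun k x => ?_).trans_eq (Finset.sum_singleton _ _)
  · rw [Finset.mem_singleton]
    exact by_contra fun h => by simp [Cc.supp, ofUnits_of_ne hg hc hU h] at hk
  · rcases eq_or_ne k 1 with rfl | h
    · rw [ofUnits_one]
      exact hgC x
    · rw [ofUnits_of_ne hg hc hU h]
      simpa using hC

theorem exists_unit_bump [T2Space X] [LocallyCompactSpace X] (hU : IsOpen U) {K : Set X}
    (hK : IsCompact K) (hKU : K ⊆ U) : ∃ (f : Cc Γ X U) (g : X → ℝ), ‖CStar.of f‖ ≤ 1 ∧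
      (∀ x, f 1 x = g x) ∧ (∀ x, 0 ≤ g x) ∧ ∀ x ∈ K, g x = 1 := by
  obtain ⟨g, hgK, hc, hgU, hg⟩ := exists_continuousMap_one_of_isCompact_subset_isOpen hK hU hKU
  have hcont : Continuous fun x => (g x : ℂ) := by fun_prop
  have hsupp : tsupport (fun x => (g x : ℂ)) ⊆ tsupport g :=
    closure_mono (Function.support_comp_subset Complex.ofReal_zero g)
  have hc' : HasCompactSupport fun x => (g x : ℂ) :=
    HasCompactSupport.comp_left (g := Complex.ofReal) hc Complex.ofReal_zero
  refine ⟨.ofUnits _ hcont hc' (hsupp.trans hgU), g, ?_,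
    fun x => congrFun (Cc.ofUnits_one hcont hc' _) x, fun x => (hg x).1, hgK⟩
  rw [CStar.norm_of]
  refine (Cc.fullNorm_le_ellOne _).trans (Cc.ellOne_ofUnits_le _ _ _ zero_le_one fun x => ?_)
  rw [Complex.norm_real, Real.norm_of_nonneg (hg x).1]
  exact (hg x).2

end UnitSpace

section RegularRepresentation

variable {Γ X : Type} [Group Γ] [MulAction Γ X] {U : Set X}

theorem summable_fiber {w : Γ → ℝ} {S : Set Γ} (hS : Summable fun k : S => w k) {y : X}
    (hy : ∀ k : Γ, k • y ∈ U → k ∈ S) : Summable fun k : Fiber U Γ y => w k.1 :=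
  hS.comp_injective (Set.inclusion_injective hy)

variable [TopologicalSpace X] [ContinuousConstSMul Γ X]

theorem extZero_stdBasis_of_ne {y : X} {k : Fiber U Γ y} {s : Γ} (hs : s ≠ k.1) :
    extZero (stdBasis k) s = 0 := by
  by_cases h : s • y ∈ U
  · have hcoe : extZero (stdBasis k) s = stdBasis k ⟨s, h⟩ := extZero_coe (stdBasis k) ⟨s, h⟩
    rw [hcoe, stdBasis_of_ne fun e => hs (congrArg Subtype.val e)]
  · exact extZero_of_notMem _ h

theorem extZero_circleMul {y : X} (u : Γ → Circle) (ξ : EllTwo (Fiber U Γ y)) (s : Γ) :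
    extZero (circleMul (fun k : Fiber U Γ y => u k.1) ξ) s = u s * extZero ξ s := by
  by_cases h : s • y ∈ U
  · exact (extZero_coe _ ⟨s, h⟩).trans (congrArg (_ * ·) (extZero_coe ξ ⟨s, h⟩).symm)
  · rw [extZero_of_notMem _ h, extZero_of_notMem _ h, mul_zero]

theorem regOp_stdBasis_self (y : X) (f : Cc Γ X U) (k : Fiber U Γ y) :
    regOp y f (stdBasis k) k = f 1 (k.1 • y) := by
  rw [regOp_apply, act, finsum_eq_single _ k.1 fun s hs => by
    rw [extZero_stdBasis_of_ne hs, mul_zero]]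
  rw [extZero_coe, stdBasis_self, mul_inv_cancel, mul_one]

theorem regOp_twist (χ : Γ →* Circle) (y : X) (f : Cc Γ X U) :
    regOp y (Cc.twist χ f) = circleMul (fun k : Fiber U Γ y => χ k.1) * regOp y f *
      circleMul (fun k : Fiber U Γ y => (χ k.1)⁻¹) := by
  ext ξ k
  rw [mul_apply_eq_comp, mul_apply_eq_comp, circleMul_apply, regOp_apply, regOp_apply, act, act,
    ← smul_eq_mul, smul_finsum]
  refine finsum_congr fun s => ?_
  rw [extZero_circleMul fun k => (χ k)⁻¹]
  change (χ (k.1 * s⁻¹) : ℂ) * f (k.1 * s⁻¹) (s • y) * extZero ξ s = _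
  rw [map_mul, map_inv, Circle.coe_mul, smul_eq_mul]
  ring

theorem continuous_regRep (y : X) : Continuous fun a : CStar Γ X U => regRep y a :=
  AddMonoidHomClass.continuous_of_bound (regRep y) 1 fun a => by
    rw [one_mul]
    exact NonUnitalStarAlgHom.norm_apply_le (regRep y) a

/-- The representation `π_y` as a continuous linear map. -/
def regRepL (y : X) :
    CStar Γ X U →L[ℂ] (EllTwo (Fiber U Γ y) →L[ℂ] EllTwo (Fiber U Γ y)) where
  toFun := regRep y
  map_add' := map_add (regRep y)
  map_smul' := map_smul (regRep y)
  cont := continuous_regRep y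

theorem continuous_twist (χ : Γ →* Circle) : Continuous fun a : CStar Γ X U => CStar.twist χ a :=
  AddMonoidHomClass.continuous_of_bound (CStar.twist χ) 1 fun a => by
    rw [one_mul]
    exact NonUnitalStarAlgHom.norm_apply_le (CStar.twist χ) a

theorem regRep_twist (χ : Γ →* Circle) (y : X) (a : CStar Γ X U) :
    regRep y (CStar.twist χ a) = circleMul (fun k : Fiber U Γ y => χ k.1) * regRep y a *
      circleMul (fun k : Fiber U Γ y => (χ k.1)⁻¹) := by
  refine CStar.induction_on a (isClosed_eq ((continuous_regRep y).comp (continuous_twist χ))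
    ((continuous_const.mul (continuous_regRep y)).mul continuous_const)) fun f => ?_
  rw [CStar.twist_of, regRep_of, regRep_of, regOp_twist]

/-- The functional `a ↦ Tr(diag(w) π_y(a))` on the C⋆-algebra of the groupoid, for summable
weights `w` on the fiber over `y`. -/
def regTrace {y : X} {w : Fiber U Γ y → ℝ} (hw : Summable w) : StrongDual ℂ (CStar Γ X U) :=
  (diagTrace hw).comp (regRepL y)

theorem regTrace_apply {y : X} {w : Fiber U Γ y → ℝ} (hw : Summable w) (a : CStar Γ X U) :
    regTrace hw a = diagTrace hw (regRep y a) := rfl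

theorem regTrace_of {y : X} {w : Fiber U Γ y → ℝ} (hw : Summable w) (f : Cc Γ X U) :
    regTrace hw (CStar.of f) = ∑' k, (w k : ℂ) * f 1 (k.1 • y) := by
  rw [regTrace_apply, regRep_of, diagTrace_apply]
  exact tsum_congr fun k => by rw [regOp_stdBasis_self]

theorem regTrace_star_mul_self {y : X} {w : Fiber U Γ y → ℝ} (hw : Summable w)
    (a : CStar Γ X U) :
    regTrace hw (star a * a) = ((∑' k, w k * ‖regRep y a (stdBasis k)‖ ^ 2 : ℝ) : ℂ) := by
  rw [regTrace_apply, map_mul, map_star, diagTrace_star_mul_self]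

theorem norm_regTrace_le {y : X} {w : Fiber U Γ y → ℝ} (hw : Summable w) :
    ‖regTrace hw‖ ≤ ∑' k, ‖w k‖ := by
  refine ContinuousLinearMap.opNorm_le_bound _ (tsum_nonneg fun _ => norm_nonneg _) fun a => ?_
  exact ((diagTrace hw).le_opNorm _).trans (mul_le_mul (norm_diagTrace_le hw)
    (NonUnitalStarAlgHom.norm_apply_le (regRep y) a) (norm_nonneg _)
    (tsum_nonneg fun _ => norm_nonneg _))

theorem sum_le_norm_regTrace [T2Space X] [LocallyCompactSpace X] (hU : IsOpen U) {y : X}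
    {w : Fiber U Γ y → ℝ} (hw : Summable w) (hw0 : ∀ k, 0 ≤ w k) (s : Finset (Fiber U Γ y)) :
    ∑ k ∈ s, w k ≤ ‖regTrace hw‖ := by
  obtain ⟨f, g, hf, hfg, hg0, hg1⟩ := exists_unit_bump (Γ := Γ) hU
    (s.finite_toSet.image fun k : Fiber U Γ y => k.1 • y).isCompact
    (by rintro _ ⟨k, -, rfl⟩; exact k.2)
  have hterm : ∀ k : Fiber U Γ y, (w k : ℂ) * regRep y (CStar.of f) (stdBasis k) k =
      ((w k * g (k.1 • y) : ℝ) : ℂ) := fun k => by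
    rw [regRep_of, regOp_stdBasis_self, hfg, Complex.ofReal_mul]
  have hsum : Summable fun k : Fiber U Γ y => w k * g (k.1 • y) :=
    Complex.summable_ofReal.1 ((summable_mul_coeff hw (regRep y (CStar.of f))).congr hterm)
  calc ∑ k ∈ s, w k = ∑ k ∈ s, w k * g (k.1 • y) :=
        Finset.sum_congr rfl fun k hk => by rw [hg1 _ ⟨k, hk, rfl⟩, mul_one]
    _ ≤ ∑' k : Fiber U Γ y, w k * g (k.1 • y) :=
        hsum.sum_le_tsum s fun k _ => mul_nonneg (hw0 k) (hg0 _)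
    _ ≤ ‖regTrace hw (CStar.of f)‖ := by
        rw [regTrace_apply, diagTrace_apply, tsum_congr hterm, ← Complex.ofReal_tsum,
          Complex.norm_real]
        exact Real.le_norm_self _
    _ ≤ ‖regTrace hw‖ :=
        ((regTrace hw).le_opNorm _).trans (mul_le_of_le_one_right (norm_nonneg _) hf)

theorem norm_regTrace [T2Space X] [LocallyCompactSpace X] (hU : IsOpen U) {y : X}
    {w : Fiber U Γ y → ℝ} (hw : Summable w) (hw0 : ∀ k, 0 ≤ w k) :
    ‖regTrace hw‖ = ∑' k, w k := by
  refine le_antisymm ?_ (hw.tsum_le_of_sum_le (sum_le_norm_regTrace hU hw hw0))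
  simpa only [Real.norm_of_nonneg (hw0 _)] using norm_regTrace_le hw

theorem continuous_apply_of_dense {Y E : Type*} [TopologicalSpace Y] [NormedAddCommGroup E]
    [NormedSpace ℂ E] {ψ : Y → StrongDual ℂ E} {C : ℝ} (hψ : ∀ y, ‖ψ y‖ ≤ C) {D : Set E}
    (hD : Dense D) (hcont : ∀ a ∈ D, Continuous fun y => ψ y a) (a : E) :
    Continuous fun y => ψ y a := by
  refine continuous_of_uniform_approx_of_continuous fun u hu => ?_
  obtain ⟨ε, hε, hu⟩ := Metric.mem_uniformity_dist.1 hu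
  obtain ⟨b, hb, hab⟩ := hD.exists_dist_lt a (div_pos hε (by positivity : 0 < |C| + 1))
  refine ⟨_, hcont b hb, fun y => hu ?_⟩
  rw [lt_div_iff₀ (by positivity), dist_eq_norm] at hab
  calc dist (ψ y a) (ψ y b) = ‖ψ y (a - b)‖ := by rw [dist_eq_norm, map_sub]
    _ ≤ ‖ψ y‖ * ‖a - b‖ := (ψ y).le_opNorm _
    _ ≤ (|C| + 1) * ‖a - b‖ :=
        mul_le_mul_of_nonneg_right (by linarith [hψ y, le_abs_self C]) (norm_nonneg _)
    _ < ε := by rwa [mul_comm]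

theorem norm_regTrace_le_tsum {w : Γ → ℝ} {S : Set Γ} (hS : Summable fun k : S => w k) {y : X}
    (hy : ∀ k : Γ, k • y ∈ U → k ∈ S) : ‖regTrace (summable_fiber hS hy)‖ ≤ ∑' k : S, ‖w k‖ :=
  (norm_regTrace_le _).trans (tsum_comp_le_tsum_of_inj hS.norm (fun _ => norm_nonneg _)
    (Set.inclusion_injective hy))

theorem regTrace_of_eq_tsum {w : Γ → ℝ} {S : Set Γ} (hS : Summable fun k : S => w k) {y : X}
    (hy : ∀ k : Γ, k • y ∈ U → k ∈ S) (f : Cc Γ X U) :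
    regTrace (summable_fiber hS hy) (CStar.of f) = ∑' k : S, (w k : ℂ) * f 1 (k.1 • y) := by
  have hsupp : (Function.support fun k : Γ => (w k : ℂ) * f 1 (k • y)) ⊆ {k | k • y ∈ U} :=
    fun k hk => (f.mem_arrows (right_ne_zero_of_mul hk)).1
  rw [regTrace_of]
  exact (tsum_subtype_eq_of_support_subset hsupp).trans
    (tsum_subtype_eq_of_support_subset (hsupp.trans hy)).symm

theorem continuous_regTrace {w : Γ → ℝ} {S : Set Γ} (hS : Summable fun k : S => w k) {Y : Set X}
    (hY : ∀ y ∈ Y, ∀ k : Γ, k • y ∈ U → k ∈ S) (a : CStar Γ X U) :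
    Continuous fun y : Y => regTrace (summable_fiber hS (hY y.1 y.2)) a := by
  refine continuous_apply_of_dense (ψ := fun y : Y => regTrace (summable_fiber hS (hY y.1 y.2)))
    (fun y => norm_regTrace_le_tsum hS (hY y.1 y.2))
    CStar.isDenseInducing_of.dense ?_ a
  rintro _ ⟨f, rfl⟩
  have hbound : Summable fun k : S => ‖w k‖ * ⨆ x, ‖f 1 x‖ := Summable.mul_right _ hS.norm
  refine (continuous_tsum (fun k => ?_) hbound fun k y => ?_).congr
    fun y : Y => (regTrace_of_eq_tsum hS (hY y.1 y.2) f).symm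
  · exact continuous_const.mul ((f.2.2 1).1.comp
      ((continuous_const_smul (k : Γ)).comp continuous_subtype_val))
  · rw [norm_mul, Complex.norm_real]
    exact mul_le_mul_of_nonneg_left (f.norm_le_iSup 1 _) (norm_nonneg _)

end RegularRepresentation

/-! ### Fractions whose denominator is a power of `p` -/

section Counting

/-- The nonzero elements of `ℤ[1/p]` of absolute value less than `lam`; for `y` in `unitBox p`
and `lam = |y_∞|⁻¹` these are the arrows of the groupoid with source `y`. -/
def boundedFractions (p : ℕ) (lam : ℝ) : Set ℚˣ :=
  {k | (∀ q : ℕ, q.Prime → q ≠ p → ¬ q ∣ (k : ℚ).den) ∧ |((k : ℚ) : ℝ)| < lam}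

/-- The exponent of `p` in the denominator of `k`; on `boundedFractions p p` it is the integer `m`
with `|k|_p = p ^ m`. -/
def denExponent (p : ℕ) (k : ℚˣ) : ℕ := padicValNat p (k : ℚ).den

/-- The nonzero integers of absolute value less than `x`. -/
def boundedIntegers (x : ℝ) : Finset ℤ := (Finset.Icc (-⌈x - 1⌉) ⌈x - 1⌉).erase 0

theorem mem_boundedIntegers {x : ℝ} {n : ℤ} : n ∈ boundedIntegers x ↔ n ≠ 0 ∧ |(n : ℝ)| < x := by
  rw [boundedIntegers, Finset.mem_erase, Finset.mem_Icc, ← abs_le, Int.ceil_sub_one,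
    Int.le_sub_one_iff, Int.lt_ceil, Int.cast_abs]

theorem card_boundedIntegers {x : ℝ} (hx : 0 < x) :
    ((boundedIntegers x).card : ℝ) = 2 * ⌈x - 1⌉ := by
  have hceil : 0 ≤ ⌈x - 1⌉ := by
    rw [Int.ceil_sub_one]
    exact Int.le_sub_one_of_lt (Int.ceil_pos.2 hx)
  have hcard : ((boundedIntegers x).card : ℤ) = 2 * ⌈x - 1⌉ := by
    rw [boundedIntegers, Finset.card_erase_of_mem (by rw [Finset.mem_Icc]; omega), Int.card_Icc]
    omega
  exact_mod_cast hcard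

variable {p : ℕ} {lam : ℝ}

theorem boundedFractions_mono {lam' : ℝ} (h : lam ≤ lam') :
    boundedFractions p lam ⊆ boundedFractions p lam' :=
  fun _ hk => ⟨hk.1, hk.2.trans_le h⟩

variable [hp : Fact p.Prime]

theorem den_eq_pow_denExponent {k : ℚˣ} (hk : k ∈ boundedFractions p lam) :
    (k : ℚ).den = p ^ denExponent p k := by
  have hpow := Nat.eq_prime_pow_of_unique_prime_dvd (p := p) (k : ℚ).den_nz fun {q} hq hqd =>
    by_contra fun hne => hk.1 q hq hne hqd
  rw [denExponent, hpow, padicValNat.prime_pow]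

/-- A nonzero integer divisible by `p` has absolute value at least `p`. -/
theorem not_dvd_num {k : ℚˣ} (hk : k ∈ boundedFractions p p) : ¬ (p : ℤ) ∣ (k : ℚ).num := by
  intro hd
  have hden : (k : ℚ).den = 1 := by
    have hnd : ¬ p ∣ (k : ℚ).den := fun h =>
      Nat.not_coprime_of_dvd_of_dvd hp.out.one_lt (Int.natCast_dvd.1 hd) h (k : ℚ).reduced
    rw [den_eq_pow_denExponent hk, denExponent, padicValNat.eq_zero_of_not_dvd hnd, pow_zero]
  have hlt : |(k : ℚ).num| < p := by
    have h := hk.2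
    rw [← Rat.coe_int_num_of_den_eq_one hden] at h
    exact_mod_cast h
  exact hlt.not_ge
    (Int.le_of_dvd (abs_pos.2 (Rat.num_ne_zero.2 k.ne_zero)) ((dvd_abs _ _).2 hd))

theorem logAbs_eq {k : ℚˣ} (hk : k ∈ boundedFractions p p) :
    logAbs p k = denExponent p k * Real.log p := by
  rw [logAbs, padicNorm.eq_zpow_of_nonzero k.ne_zero, padicValRat_def,
    padicValInt.eq_zero_of_not_dvd (not_dvd_num hk)]
  simp [denExponent]

theorem logAbs_nonneg {k : ℚˣ} (hk : k ∈ boundedFractions p p) : 0 ≤ logAbs p k := by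
  rw [logAbs_eq hk]
  exact mul_nonneg (Nat.cast_nonneg _) (Real.log_natCast_nonneg p)

variable (p) in
/-- The fraction `n / p ^ j` as an invertible element of `ℚ`. -/
def fractionUnit (j : ℕ) (n : ℤ) (hn : n ≠ 0) : ℚˣ :=
  Units.mk0 ((n : ℚ) / (p : ℚ) ^ j)
    (div_ne_zero (Int.cast_ne_zero.2 hn) (pow_ne_zero _ (Nat.cast_ne_zero.2 hp.out.ne_zero)))

theorem coe_fractionUnit (j : ℕ) {n : ℤ} (hn : n ≠ 0) :
    (fractionUnit p j n hn : ℚ) = n / (p : ℚ) ^ j := rfl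

theorem fractionUnit_inj {j : ℕ} {m n : ℤ} (hm : m ≠ 0) (hn : n ≠ 0) :
    fractionUnit p j m hm = fractionUnit p j n hn ↔ m = n := by
  rw [Units.ext_iff, coe_fractionUnit, coe_fractionUnit,
    div_left_inj' (pow_ne_zero _ (Nat.cast_ne_zero.2 hp.out.ne_zero)), Int.cast_inj]

theorem den_fractionUnit_dvd (j : ℕ) {n : ℤ} (hn : n ≠ 0) :
    (fractionUnit p j n hn : ℚ).den ∣ p ^ j := by
  have h := Rat.den_dvd n ((p ^ j : ℕ) : ℤ)
  rw [Rat.divInt_eq_div] at h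
  rw [coe_fractionUnit]
  exact_mod_cast h

theorem fractionUnit_mem_boundedFractions {j : ℕ} {n : ℤ} {hn : n ≠ 0} :
    fractionUnit p j n hn ∈ boundedFractions p lam ↔ |(n : ℝ)| < lam * (p : ℝ) ^ j := by
  have hpj : (0 : ℝ) < (p : ℝ) ^ j := pow_pos (Nat.cast_pos.2 hp.out.pos) j
  have habs : |((fractionUnit p j n hn : ℚ) : ℝ)| < lam ↔ |(n : ℝ)| < lam * (p : ℝ) ^ j := by
    rw [coe_fractionUnit, Rat.cast_div, Rat.cast_intCast, Rat.cast_pow, Rat.cast_natCast, abs_div,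
      abs_of_pos hpj, div_lt_iff₀ hpj]
  refine (and_iff_right fun q hq hne hd => hne ?_).trans habs
  exact (Nat.prime_dvd_prime_iff_eq hq hp.out).1
    (hq.dvd_of_dvd_pow (hd.trans (den_fractionUnit_dvd j hn)))

theorem denExponent_le_iff {k : ℚˣ} (hk : k ∈ boundedFractions p lam) {j : ℕ} :
    denExponent p k ≤ j ↔ ∃ n, ∃ hn : n ≠ 0, fractionUnit p j n hn = k := by
  rw [← Nat.pow_dvd_pow_iff_le_right hp.out.one_lt, ← den_eq_pow_denExponent hk]
  constructor
  · rintro ⟨c, hc⟩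
    have hp0 : (p : ℚ) ^ j ≠ 0 := pow_ne_zero _ (Nat.cast_ne_zero.2 hp.out.ne_zero)
    have hpc : (p : ℚ) ^ j = (k : ℚ).den * c := by exact_mod_cast hc
    have hkc : (((k : ℚ).num * c : ℤ) : ℚ) = k * (p : ℚ) ^ j := by
      rw [hpc, ← mul_assoc, Rat.mul_den_eq_num, Int.cast_mul, Int.cast_natCast]
    refine ⟨(k : ℚ).num * c, fun h => mul_ne_zero k.ne_zero hp0 ?_, Units.ext ?_⟩
    · rw [← hkc, h, Int.cast_zero]
    · rw [coe_fractionUnit, hkc, mul_div_cancel_right₀ _ hp0]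
  · rintro ⟨n, hn, rfl⟩
    exact den_fractionUnit_dvd j hn

theorem hasSum_indicator_denExponent_le (hlam : 0 < lam) (j : ℕ) :
    HasSum (fun k : boundedFractions p lam => if denExponent p k ≤ j then (1 : ℝ) else 0)
      (2 * ⌈lam * (p : ℝ) ^ j - 1⌉) := by
  let φ : boundedIntegers (lam * (p : ℝ) ^ j) → boundedFractions p lam := fun n =>
    ⟨fractionUnit p j n (mem_boundedIntegers.1 n.2).1,
      fractionUnit_mem_boundedFractions.2 (mem_boundedIntegers.1 n.2).2⟩
  have hφ : Function.Injective φ := fun m n h =>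
    Subtype.ext ((fractionUnit_inj (mem_boundedIntegers.1 m.2).1 (mem_boundedIntegers.1 n.2).1).1
      (congrArg Subtype.val h))
  have hrange : ∀ k, k ∈ Set.range φ ↔ denExponent p k ≤ j := by
    refine fun k => ⟨?_, fun h => ?_⟩
    · rintro ⟨n, rfl⟩
      exact (denExponent_le_iff (φ n).2).2 ⟨n, (mem_boundedIntegers.1 n.2).1, rfl⟩
    · obtain ⟨n, hn, hnk⟩ := (denExponent_le_iff k.2).1 h
      have hlt := fractionUnit_mem_boundedFractions.1 (hnk ▸ k.2)
      exact ⟨⟨n, mem_boundedIntegers.2 ⟨hn, hlt⟩⟩, Subtype.ext hnk⟩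
  have hone : ((fun k : boundedFractions p lam => if denExponent p k ≤ j then (1 : ℝ) else 0) ∘ φ) =
      fun _ => 1 := funext fun n => if_pos ((hrange _).1 ⟨n, rfl⟩)
  rw [← hφ.hasSum_iff fun k hk => if_neg (mt (hrange k).2 hk), hone,
    ← card_boundedIntegers (mul_pos hlam (pow_pos (Nat.cast_pos.2 hp.out.pos) j))]
  simpa using hasSum_fintype fun _ : boundedIntegers (lam * (p : ℝ) ^ j) => (1 : ℝ)

theorem logAbs_fractionUnit_one (j : ℕ) :
    logAbs p (fractionUnit p j 1 one_ne_zero) = j * Real.log p := by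
  rw [logAbs, coe_fractionUnit, Int.cast_one, padicNorm.div, padicNorm.one,
    IsAbsoluteValue.abv_pow (padicNorm p), padicNorm.padicNorm_p_of_prime, inv_pow, one_div,
    inv_inv, Rat.cast_pow, Rat.cast_natCast, Real.log_pow]

theorem range_logAbs (h1 : 1 < lam) (h2 : lam ≤ p) :
    (Set.range fun k : boundedFractions p lam => logAbs p k) =
      Set.range fun j : ℕ => (j * Real.log p : ℝ) := by
  refine Set.Subset.antisymm ?_ ?_
  · rintro _ ⟨k, rfl⟩
    exact ⟨denExponent p k, (logAbs_eq (boundedFractions_mono h2 k.2)).symm⟩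
  · rintro _ ⟨j, rfl⟩
    have hpj : (1 : ℝ) ≤ (p : ℝ) ^ j := one_le_pow₀ (Nat.one_le_cast.2 hp.out.one_le)
    refine ⟨⟨fractionUnit p j 1 one_ne_zero, fractionUnit_mem_boundedFractions.2 ?_⟩,
      logAbs_fractionUnit_one j⟩
    rw [Int.cast_one, abs_one]
    exact h1.trans_le (le_mul_of_one_le_right (by linarith) hpj)

end Counting

/-! ### The partition function -/

section PartitionFunction

theorem hasSum_comm_of_nonneg {α γ : Type*} {G : α → γ → ℝ} (hG : ∀ a b, 0 ≤ G a b)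
    {R : α → ℝ} {C : γ → ℝ} {s : ℝ} (hrow : ∀ a, HasSum (fun b => G a b) (R a))
    (hcol : ∀ b, HasSum (fun a => G a b) (C b)) (htot : HasSum R s) : HasSum C s := by
  have hsum : Summable fun x : α × γ => G x.1 x.2 := by
    rw [summable_prod_of_nonneg fun x => hG x.1 x.2]
    exact ⟨fun a => (hrow a).summable, htot.summable.congr fun a => (hrow a).tsum_eq.symm⟩
  have hswap : HasSum (fun x : γ × α => G x.2 x.1) (∑' x : α × γ, G x.1 x.2) :=
    (Equiv.prodComm γ α).hasSum_iff.mpr hsum.hasSum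
  rw [← (hsum.hasSum.prod_fiberwise hrow).unique htot]
  exact hswap.prod_fiberwise hcol

theorem hasSum_geometric_tail {q : ℝ} (hq0 : 0 ≤ q) (hq1 : q < 1) (e : ℕ) :
    HasSum (fun j : ℕ => ((1 - q) * q ^ j) * if e ≤ j then 1 else 0) (q ^ e) := by
  have hgeom := (hasSum_geometric_of_lt_one hq0 hq1).mul_left ((1 - q) * q ^ e)
  rw [mul_right_comm, mul_inv_cancel₀ (sub_ne_zero.2 hq1.ne'), one_mul] at hgeom
  rw [← (add_left_injective e).hasSum_iff]
  · refine hgeom.congr_fun fun j => ?_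
    rw [Function.comp_apply, if_pos (Nat.le_add_left e j), pow_add]
    ring
  · intro j hj
    rw [if_neg, mul_zero]
    exact fun hle => hj ⟨j - e, Nat.sub_add_cancel hle⟩

variable {p : ℕ} {lam q : ℝ}

theorem sum_digit_mul_pow (hp : 2 ≤ p) (h1 : 1 < lam) (h2 : lam ≤ p) (n : ℕ) :
    ∑ k ∈ Finset.range (n + 1), (digit p lam k * q ^ k) * (p * q) ^ (n - k) =
      ⌈lam * (p : ℝ) ^ n - 1⌉ * q ^ n := by
  have : (p : ℝ) ≠ 0 := by positivity
  have hterm : ∀ k ∈ Finset.range (n + 1), (digit p lam k * q ^ k) * (p * q) ^ (n - k) =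
      (digit p lam k * (p : ℝ) ^ (-(k : ℤ))) * (p * q) ^ n := by
    intro k hk
    have hsplit : (p * q) ^ n = (p * q) ^ (n - k) * (p * q) ^ k :=
      (pow_sub_mul_pow _ (Nat.lt_succ_iff.1 (Finset.mem_range.1 hk))).symm
    rw [hsplit, zpow_neg, zpow_natCast, mul_pow (p : ℝ) q k]
    field_simp
  rw [Finset.sum_congr rfl hterm, ← Finset.sum_mul, sum_digit p hp lam h1 h2, zpow_neg,
    zpow_natCast, mul_pow]
  field_simp

theorem norm_digit_le (hp : 2 ≤ p) (k : ℕ) : ‖(digit p lam k : ℝ)‖ ≤ p := by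
  obtain ⟨h0, hle⟩ := digit_mem p hp lam k
  rw [Real.norm_of_nonneg (Int.cast_nonneg h0)]
  exact_mod_cast hle.trans (sub_le_self _ zero_le_one)

/-- The partial sums of the digit expansion turn the digits into the numerators `⌈lam p^j - 1⌉`, so
the generating series of the numerators is a Cauchy product with a geometric series. -/
theorem hasSum_ceil_mul_pow (hp : 2 ≤ p) (h1 : 1 < lam) (h2 : lam ≤ p) (hq0 : 0 ≤ q)
    (hq : p * q < 1) :
    HasSum (fun j : ℕ => (⌈lam * (p : ℝ) ^ j - 1⌉ : ℝ) * q ^ j)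
      ((∑' j, (digit p lam j : ℝ) * q ^ j) * (1 - p * q)⁻¹) := by
  have hp1 : (1 : ℝ) ≤ p := by exact_mod_cast one_le_two.trans hp
  have hq1 : q < 1 := (le_mul_of_one_le_left hq0 hp1).trans_lt hq
  have hpq : 0 ≤ p * q := mul_nonneg (by linarith) hq0
  have hdigit : Summable fun j => ‖(digit p lam j : ℝ) * q ^ j‖ := by
    refine Summable.of_nonneg_of_le (fun _ => norm_nonneg _) (fun j => ?_)
      ((summable_geometric_of_lt_one hq0 hq1).mul_left (p : ℝ))
    rw [norm_mul, Real.norm_of_nonneg (pow_nonneg hq0 j)]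
    exact mul_le_mul_of_nonneg_right (norm_digit_le hp j) (pow_nonneg hq0 j)
  have hgeom : Summable fun j => ‖(p * q) ^ j‖ := by
    simpa only [Real.norm_of_nonneg (pow_nonneg hpq _)] using summable_geometric_of_lt_one hpq hq
  rw [← tsum_geometric_of_lt_one hpq hq]
  simpa only [sum_digit_mul_pow hp h1 h2] using
    hasSum_sum_range_mul_of_summable_norm hdigit hgeom

theorem digitSum_eq (β : ℝ) :
    digitSum p lam β = ∑' j, (digit p lam j : ℝ) * ((p : ℝ) ^ (-β)) ^ j := by
  refine tsum_congr fun j => ?_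
  rw [← Real.rpow_natCast, ← Real.rpow_mul (Nat.cast_nonneg p), neg_mul, mul_comm β]

variable [hp : Fact p.Prime]

theorem hasSum_pow_denExponent (h1 : 1 < lam) (h2 : lam ≤ p) (hq0 : 0 ≤ q) (hq : p * q < 1) :
    HasSum (fun k : boundedFractions p lam => q ^ denExponent p k)
      (2 * ((1 - q) / (1 - p * q)) * ∑' j, (digit p lam j : ℝ) * q ^ j) := by
  have hq1 : q < 1 :=
    (le_mul_of_one_le_left hq0 (Nat.one_le_cast.2 hp.out.one_le)).trans_lt hq
  have htot : HasSum (fun j : ℕ => ((1 - q) * q ^ j) * (2 * (⌈lam * (p : ℝ) ^ j - 1⌉ : ℝ)))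
      (2 * ((1 - q) / (1 - p * q)) * ∑' j, (digit p lam j : ℝ) * q ^ j) := by
    rw [show 2 * ((1 - q) / (1 - p * q)) * ∑' j, (digit p lam j : ℝ) * q ^ j =
      2 * (1 - q) * ((∑' j, (digit p lam j : ℝ) * q ^ j) * (1 - p * q)⁻¹) by ring]
    exact ((hasSum_ceil_mul_pow hp.out.two_le h1 h2 hq0 hq).mul_left (2 * (1 - q))).congr_fun
      fun j => by ring
  refine hasSum_comm_of_nonneg
    (G := fun j (k : boundedFractions p lam) =>
      ((1 - q) * q ^ j) * if denExponent p k ≤ j then 1 else 0) (fun j k => ?_)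
    (fun j => (hasSum_indicator_denExponent_le (by linarith) j).mul_left _)
    (fun k => hasSum_geometric_tail hq0 hq1 _) htot
  exact mul_nonneg (mul_nonneg (by linarith) (pow_nonneg hq0 j)) (by split_ifs <;> norm_num)

theorem exp_neg_mul_logAbs {k : ℚˣ} (hk : k ∈ boundedFractions p p) (β : ℝ) :
    Real.exp (-β * logAbs p k) = ((p : ℝ) ^ (-β)) ^ denExponent p k := by
  rw [logAbs_eq hk, Real.rpow_def_of_pos (Nat.cast_pos.2 hp.out.pos), ← Real.exp_nat_mul]
  congr 1
  ring

theorem hasSum_exp_neg_mul_logAbs (h1 : 1 < lam) (h2 : lam ≤ p) {β : ℝ} (hβ : 1 < β) :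
    HasSum (fun k : boundedFractions p lam => Real.exp (-β * logAbs p k))
      (partitionFunction p lam β) := by
  have hp1 : (1 : ℝ) < p := Nat.one_lt_cast.2 hp.out.one_lt
  have hmul : (p : ℝ) * (p : ℝ) ^ (-β) = (p : ℝ) ^ (1 - β) := by
    rw [sub_eq_add_neg, Real.rpow_add (by linarith), Real.rpow_one]
  have hlt : (p : ℝ) * (p : ℝ) ^ (-β) < 1 := by
    rw [hmul]
    exact Real.rpow_lt_one_of_one_lt_of_neg hp1 (by linarith)
  have h := hasSum_pow_denExponent h1 h2 (Real.rpow_nonneg (Nat.cast_nonneg p) (-β)) hlt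
  rw [hmul, ← digitSum_eq] at h
  exact h.congr_fun fun k => exp_neg_mul_logAbs (boundedFractions_mono h2 k.2) β

end PartitionFunction

/-! ### Adeles of the rational numbers -/

section AdeleTopology

open NumberField IsDedekindDomain

theorem isCompact_adicCompletionIntegers (w : HeightOneSpectrum ℤ) :
    IsCompact (w.adicCompletionIntegers ℚ : Set (w.adicCompletion ℚ)) := by
  have : Fact (Rat.HeightOneSpectrum.primesEquiv w : ℕ).Prime :=
    ⟨(Rat.HeightOneSpectrum.primesEquiv w).2⟩
  have hpadic : IsCompact (PadicInt.subring (Rat.HeightOneSpectrum.primesEquiv w) : Set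
      ℚ_[Rat.HeightOneSpectrum.primesEquiv w]) :=
    isCompact_iff_compactSpace.2 (PadicInt.compactSpace _)
  rw [← (Rat.HeightOneSpectrum.adicCompletion.padicEquiv w).toHomeomorph.isCompact_image]
  exact (Rat.HeightOneSpectrum.adicCompletion.padicEquiv_bijOn w).image_eq ▸ hpadic

theorem isOpen_adicCompletionIntegers (w : HeightOneSpectrum ℤ) :
    IsOpen (w.adicCompletionIntegers ℚ : Set (w.adicCompletion ℚ)) :=
  Valued.isOpen_valuationSubring _

instance locallyCompactSpace_finiteAdeleRing : LocallyCompactSpace (FiniteAdeleRing ℤ ℚ) := by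
  have : Fact (∀ w : HeightOneSpectrum ℤ,
      IsOpen (w.adicCompletionIntegers ℚ : Set (w.adicCompletion ℚ))) :=
    ⟨isOpen_adicCompletionIntegers⟩
  have (w : HeightOneSpectrum ℤ) : CompactSpace (w.adicCompletionIntegers ℚ) :=
    isCompact_iff_compactSpace.1 (isCompact_adicCompletionIntegers w)
  exact inferInstanceAs (LocallyCompactSpace (RestrictedProduct
    (fun w : HeightOneSpectrum ℤ => w.adicCompletion ℚ)
    (fun w => (w.adicCompletionIntegers ℚ : Set (w.adicCompletion ℚ))) cofinite))

instance t2Space_finiteAdeleRing : T2Space (FiniteAdeleRing ℤ ℚ) :=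
  inferInstanceAs (T2Space (RestrictedProduct
    (fun w : HeightOneSpectrum ℤ => w.adicCompletion ℚ)
    (fun w => (w.adicCompletionIntegers ℚ : Set (w.adicCompletion ℚ))) cofinite))

instance locallyCompactSpace_adeleRing : LocallyCompactSpace (AdeleRing ℤ ℚ) :=
  inferInstanceAs (LocallyCompactSpace (InfiniteAdeleRing ℚ × FiniteAdeleRing ℤ ℚ))

instance t2Space_adeleRing : T2Space (AdeleRing ℤ ℚ) :=
  have : T2Space (InfiniteAdeleRing ℚ) :=
    inferInstanceAs (T2Space ((v : InfinitePlace ℚ) → v.Completion))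
  inferInstanceAs (T2Space (InfiniteAdeleRing ℚ × FiniteAdeleRing ℤ ℚ))

theorem continuous_finite_component (w : HeightOneSpectrum ℤ) :
    Continuous fun a : AdeleRing ℤ ℚ => a.2 w :=
  (RestrictedProduct.continuous_eval (R := fun w : HeightOneSpectrum ℤ => w.adicCompletion ℚ)
    (A := fun w => (w.adicCompletionIntegers ℚ : Set (w.adicCompletion ℚ))) w).comp
    (continuous_snd : Continuous fun a : InfiniteAdeleRing ℚ × FiniteAdeleRing ℤ ℚ => a.2)

theorem valuation_le_one_iff_not_dvd_den (w : HeightOneSpectrum ℤ) (x : ℚ) :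
    w.valuation ℚ x ≤ 1 ↔ ¬ (Rat.HeightOneSpectrum.primesEquiv w : ℕ) ∣ x.den := by
  have : Fact (Rat.HeightOneSpectrum.primesEquiv w : ℕ).Prime :=
    ⟨(Rat.HeightOneSpectrum.primesEquiv w).2⟩
  rw [(Rat.HeightOneSpectrum.valuation_equiv_padicValuation w).le_one_iff_le_one]
  exact Rat.padicValuation_le_one_iff

variable {p : ℕ} [hp : Fact p.Prime]

instance : T2Space (AdeleAt p) :=
  inferInstanceAs (T2Space {a : AdeleRing ℤ ℚ // a.2 (place p) = 0})

instance : LocallyCompactSpace (AdeleAt p) := by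
  have hclosed : IsClosed {a : AdeleRing ℤ ℚ | a.2 (place p) = 0} :=
    isClosed_eq (continuous_finite_component _) continuous_const
  exact hclosed.isClosedEmbedding_subtypeVal.locallyCompactSpace

theorem continuous_absInf : Continuous (absInf : AdeleAt p → ℝ) := by
  have hinf : Continuous fun a : InfiniteAdeleRing ℚ × FiniteAdeleRing ℤ ℚ =>
      a.1 Rat.infinitePlace := (continuous_apply Rat.infinitePlace).comp continuous_fst
  exact (hinf.comp (continuous_subtype_val (p := fun a : AdeleRing ℤ ℚ => a.2 (place p) = 0))).norm

theorem isOpen_openBox : IsOpen (openBox p) := by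
  have hfin : IsOpen {a : FiniteAdeleRing ℤ ℚ | ∀ w, a w ∈ w.adicCompletionIntegers ℚ} :=
    RestrictedProduct.isOpen_forall_mem (R := fun w : HeightOneSpectrum ℤ => w.adicCompletion ℚ)
      (A := fun w => (w.adicCompletionIntegers ℚ : Set (w.adicCompletion ℚ)))
      isOpen_adicCompletionIntegers
  have hproj : Continuous fun a : AdeleAt p => a.1.2 :=
    (continuous_snd (X := InfiniteAdeleRing ℚ) (Y := FiniteAdeleRing ℤ ℚ)).comp
      (continuous_subtype_val (p := fun a : AdeleRing ℤ ℚ => a.2 (place p) = 0))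
  exact (isOpen_lt continuous_absInf continuous_const).inter (hfin.preimage hproj)

theorem absInf_smul (k : ℚˣ) (y : AdeleAt p) : absInf (k • y) = |((k : ℚ) : ℝ)| * absInf y := by
  have hcoe : (algebraMap ℚ (AdeleRing ℤ ℚ) k).1 Rat.infinitePlace =
      ((k : ℚ) : Rat.infinitePlace.Completion) :=
    eq_ratCast (algebraMap ℚ Rat.infinitePlace.Completion) _
  calc absInf (k • y)
      = ‖(algebraMap ℚ (AdeleRing ℤ ℚ) k).1 Rat.infinitePlace * y.1.1 Rat.infinitePlace‖ := rfl
    _ = |((k : ℚ) : ℝ)| * ‖y.1.1 Rat.infinitePlace‖ := by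
      rw [norm_mul, hcoe, InfinitePlace.Completion.Rat.norm_infinitePlace_completion, Rat.cast_abs]

theorem valued_smul (k : ℚˣ) (y : AdeleAt p) (w : HeightOneSpectrum ℤ) :
    Valued.v ((k • y).1.2 w) = w.valuation ℚ (k : ℚ) * Valued.v (y.1.2 w) := by
  have hmul : (k • y).1.2 w = (algebraMap ℚ (AdeleRing ℤ ℚ) k).2 w * y.1.2 w := rfl
  rw [hmul, map_mul]
  congr 1
  exact w.valuedAdicCompletion_eq_valuation' (k : ℚ)

theorem absInf_pos {y : AdeleAt p} (hy : y ∈ unitBox p) : 0 < absInf y :=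
  (inv_pos.2 (Nat.cast_pos.2 hp.out.pos)).trans_le hy.2.1

theorem one_lt_inv_absInf {y : AdeleAt p} (hy : y ∈ unitBox p) : 1 < (absInf y)⁻¹ :=
  (one_lt_inv₀ (absInf_pos hy)).2 hy.2.2

theorem inv_absInf_le {y : AdeleAt p} (hy : y ∈ unitBox p) : (absInf y)⁻¹ ≤ p :=
  inv_le_of_inv_le₀ (Nat.cast_pos.2 hp.out.pos) hy.2.1

theorem valued_smul_le_one_iff {y : AdeleAt p} (hy : y ∈ unitBox p) (k : ℚˣ)
    (w : HeightOneSpectrum ℤ) :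
    Valued.v ((k • y).1.2 w) ≤ 1 ↔
      (w ≠ place p → ¬ (Rat.HeightOneSpectrum.primesEquiv w : ℕ) ∣ (k : ℚ).den) := by
  rw [valued_smul]
  obtain rfl | hw := eq_or_ne w (place p)
  · rw [y.2, map_zero, mul_zero]
    exact iff_of_true zero_le_one fun h => (h rfl).elim
  · rw [hy.1 w hw, mul_one, valuation_le_one_iff_not_dvd_den, forall_prop_of_true hw]

theorem forall_valued_smul_le_one_iff {y : AdeleAt p} (hy : y ∈ unitBox p) (k : ℚˣ) :
    (∀ w : HeightOneSpectrum ℤ, Valued.v ((k • y).1.2 w) ≤ 1) ↔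
      ∀ q : ℕ, q.Prime → q ≠ p → ¬ q ∣ (k : ℚ).den := by
  have hplace (q : Nat.Primes) :
      Rat.HeightOneSpectrum.primesEquiv.symm q ≠ place p ↔ (q : ℕ) ≠ p :=
    Rat.HeightOneSpectrum.primesEquiv.symm.injective.ne_iff.trans Subtype.coe_ne_coe.symm
  simp only [valued_smul_le_one_iff hy]
  rw [← Rat.HeightOneSpectrum.primesEquiv.symm.forall_congr_right]
  simp only [Equiv.apply_symm_apply, hplace]
  exact ⟨fun H q hq => H ⟨q, hq⟩, fun H q => H q q.2⟩

theorem smul_mem_openBox_iff {y : AdeleAt p} (hy : y ∈ unitBox p) (k : ℚˣ) :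
    k • y ∈ openBox p ↔ k ∈ boundedFractions p (absInf y)⁻¹ := by
  have harch : absInf (k • y) < 1 ↔ |((k : ℚ) : ℝ)| < (absInf y)⁻¹ := by
    rw [absInf_smul, inv_eq_one_div, lt_div_iff₀ (absInf_pos hy)]
  exact (and_congr harch (forall_valued_smul_le_one_iff hy k)).trans and_comm

end AdeleTopology

/-! ### Positive energy and Gibbs functionals -/

section Gibbs

variable {p : ℕ} [hp : Fact p.Prime]

theorem mem_boundedFractions_of_smul_mem {y : AdeleAt p} (hy : y ∈ unitBox p) (k : ℚˣ)
    (hk : k • y ∈ openBox p) : k ∈ boundedFractions p p :=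
  boundedFractions_mono (inv_absInf_le hy) ((smul_mem_openBox_iff hy k).1 hk)

theorem range_logAbs_orbit {y : AdeleAt p} (hy : y ∈ unitBox p) :
    (Set.range fun k : Orbit y => logAbs p k.1) = Set.range fun j : ℕ => (j * Real.log p : ℝ) := by
  rw [← range_logAbs (one_lt_inv_absInf hy) (inv_absInf_le hy)]
  exact (Equiv.subtypeEquivRight (smul_mem_openBox_iff hy)).surjective.range_comp
    fun k : boundedFractions p (absInf y)⁻¹ => logAbs p k

theorem isClosed_range_natCast_mul {c : ℝ} (hc : c ≠ 0) :
    IsClosed (Set.range fun k : ℕ => ((k * c : ℝ) : ℂ)) :=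
  (Complex.isometry_ofReal.isClosedEmbedding.comp <| (Homeomorph.mulRight₀ c hc).isClosedEmbedding
    |>.comp Nat.isClosedEmbedding_coe_real).isClosed_range

theorem unboundedSpectrum_hamiltonian {y : AdeleAt p} (hy : y ∈ unitBox p) :
    unboundedSpectrum (hamiltonian y) = Set.range fun k : ℕ => ((k * Real.log p : ℝ) : ℂ) := by
  have hlog : Real.log p ≠ 0 := (Real.log_pos (Nat.one_lt_cast.2 hp.out.one_lt)).ne'
  have hrange : (Set.range fun k : Orbit y => (logAbs p k.1 : ℂ)) =
      Set.range fun k : ℕ => ((k * Real.log p : ℝ) : ℂ) := by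
    have := congrArg (Complex.ofReal '' ·) (range_logAbs_orbit hy)
    simpa only [← Set.range_comp, Function.comp_def] using this
  rw [hamiltonian, unboundedSpectrum_mulOp, hrange, (isClosed_range_natCast_mul hlog).closure_eq]

theorem rep_evolution (y : AdeleAt p) (t : ℝ) (a : Alg p) :
    rep y (evolution p t a) = expMul (fun k : Orbit y => logAbs p k.1) t * rep y a *
      expMul (fun k : Orbit y => logAbs p k.1) (-t) := by
  have hinv : (fun k : Orbit y => (timeChar p t k.1)⁻¹) =
      fun k => Circle.exp (-t * logAbs p k.1) := funext fun k => by
    rw [neg_mul, Circle.exp_neg]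
    rfl
  rw [rep, evolution, regRep_twist, hinv]
  rfl

theorem isPositiveEnergy_rep {y : AdeleAt p} (hy : y ∈ unitBox p) :
    IsPositiveEnergy (fun t a => evolution p t a) (fun a => rep y a) (hamiltonian y) :=
  ⟨⟨isSelfAdjoint_mulOp _, _, isExpOf_expMul _, rep_evolution y⟩,
    mulOp_nonneg fun k => logAbs_nonneg (mem_boundedFractions_of_smul_mem hy k.1 k.2)⟩

variable {β : ℝ} (hβ : 1 < β)

include hβ

theorem hasSum_orbit {y : AdeleAt p} (hy : y ∈ unitBox p) :
    HasSum (fun k : Orbit y => Real.exp (-β * logAbs p k.1))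
      (partitionFunction p (absInf y)⁻¹ β) :=
  (Equiv.subtypeEquivRight (smul_mem_openBox_iff hy)).hasSum_iff.mpr
    (hasSum_exp_neg_mul_logAbs (one_lt_inv_absInf hy) (inv_absInf_le hy) hβ)

theorem summable_boundedFractions :
    Summable fun k : boundedFractions p p => Real.exp (-β * logAbs p k) :=
  (hasSum_exp_neg_mul_logAbs (Nat.one_lt_cast.2 hp.out.one_lt) le_rfl hβ).summable

theorem hasTrace_expNegHamiltonian {y : AdeleAt p} (hy : y ∈ unitBox p) :
    HasTrace (expNegHamiltonian β y) (partitionFunction p (absInf y)⁻¹ β : ℂ) := by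
  have h := hasTrace_boundedMulOp_mul (hasSum_orbit hβ hy).summable 1
  rwa [mul_one, diagTrace_one, (hasSum_orbit hβ hy).tsum_eq] at h

/-- The functional `ψ_{β,y} : a ↦ Tr(e^{-βH_y} π_y(a))`. -/
def gibbs (y : unitBox p) : StrongDual ℂ (Alg p) :=
  regTrace (hasSum_orbit hβ y.2).summable

theorem hasTrace_gibbs (y : unitBox p) (a : Alg p) :
    HasTrace (expNegHamiltonian β y.1 * rep y.1 a) (gibbs hβ y a) :=
  hasTrace_boundedMulOp_mul (hasSum_orbit hβ y.2).summable _

theorem gibbs_star_mul_self_nonneg (y : unitBox p) (a : Alg p) :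
    0 ≤ (gibbs hβ y (star a * a)).re ∧ (gibbs hβ y (star a * a)).im = 0 := by
  rw [gibbs, regTrace_star_mul_self, Complex.ofReal_re, Complex.ofReal_im]
  exact ⟨tsum_nonneg fun k => mul_nonneg (Real.exp_pos _).le (sq_nonneg _), rfl⟩

theorem norm_gibbs (y : unitBox p) : ‖gibbs hβ y‖ = partitionFunction p (absInf y.1)⁻¹ β :=
  (norm_regTrace isOpen_openBox _ fun _ => (Real.exp_pos _).le).trans (hasSum_orbit hβ y.2).tsum_eq

theorem isKMS_gibbs (y : unitBox p) : IsKMS (fun t a => evolution p t a) β (gibbs hβ y) :=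
  (isKMS_diagTrace (zero_le_one.trans hβ.le) (hasSum_orbit hβ y.2).summable).comp (rep y.1)
    (rep_evolution y.1)

theorem continuous_gibbs (a : Alg p) : Continuous fun y : unitBox p => gibbs hβ y a :=
  continuous_regTrace (w := fun k => Real.exp (-β * logAbs p k)) (summable_boundedFractions hβ)
    (fun _ hy => mem_boundedFractions_of_smul_mem hy) a

end Gibbs

end ValuationSystem
end

open ValuationSystem in
theorem theorem8p13 (p : ℕ) [Fact p.Prime] :
    -- positive energy and the spectrum of the Hamiltonian
    (∀ y ∈ unitBox p,
      IsPositiveEnergy (fun t a => evolution p t a) (fun a => rep y a) (hamiltonian y) ∧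
      unboundedSpectrum (hamiltonian y) = Set.range fun k : ℕ => ((k * Real.log p : ℝ) : ℂ)) ∧
    ∀ β : ℝ, 1 < β →
      -- the partition function
      (∀ y ∈ unitBox p, ∀ lam : ℝ, absInf y = lam⁻¹ →
        HasTrace (expNegHamiltonian β y) (partitionFunction p lam β : ℂ)) ∧
      -- the KMS functionals
      ∃ ψ : unitBox p → StrongDual ℂ (Alg p),
        (∀ (y : unitBox p) (a : Alg p),
          HasTrace (expNegHamiltonian β y.1 * rep y.1 a) (ψ y a)) ∧
        (∀ (y : unitBox p) (a : Alg p),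
          0 ≤ (ψ y (star a * a)).re ∧ (ψ y (star a * a)).im = 0) ∧
        (∀ y : unitBox p, ‖ψ y‖ = partitionFunction p (absInf y.1)⁻¹ β) ∧
        (∀ y : unitBox p, IsKMS (fun t a => evolution p t a) β (ψ y)) ∧
        ∀ a : Alg p, Continuous fun y : unitBox p => ψ y a := by
  refine ⟨fun y hy => ⟨isPositiveEnergy_rep hy, unboundedSpectrum_hamiltonian hy⟩, fun β hβ =>
    ⟨fun y hy lam hlam => ?_, gibbs hβ, hasTrace_gibbs hβ, gibbs_star_mul_self_nonneg hβ,
      norm_gibbs hβ, isKMS_gibbs hβ, continuous_gibbs hβ⟩⟩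
  rw [← inv_inv lam, ← hlam]
  exact hasTrace_expNegHamiltonian hβ hy
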